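/- Consider the linear model $y = X\theta + w$ with a standard Gaussian design: $X\in\mathbb{R}^{n\times p}$ has i.i.d. $N(0,1)$ entries (rows i.i.d. $N(0,I_{p\times p})$), and $w\sim N(0,\sigma^2 I_{n\times n})$ is independent of $X$, with $\sigma>0$. Let $\mathbb{P}_\theta$ be the resulting law of $(y,X)$, and write $\|\theta\|_0$ for the number of non-zero entries of $\theta$. Fix $i\in\{1,\dots,p\}$ and a sparsity level $1\le s_0\le p$. A (randomized) test $T$ is a measurable $\{0,1\}$-valued function of $(y,X,U)$, with $U$ uniform on $[0,1]$ and independent of $(y,X)$. For $\mu>0$ put $$\alpha_i(T)=\sup\{\mathbb{P}_\theta(T=1):\ \|\theta\|_0\le s_0,\ \theta_i=0\},\qquad \beta_i(T;\mu)=\sup\{\mathbb{P}_\theta(T=0):\ \|\theta\|_0\le s_0,\ |\theta_i|\ge\mu\},$$ and for $\alpha\in[0,1]$ let the minimax power be $$1-\beta_i^{\rm opt}(\alpha;\mu)=\sup\{1-\beta_i(T;\mu):\ \alpha_i(T)\le\alpha\}.$$ Let $\Phi$ be the standard normal distribution function (with $\Phi(\pm\infty)\in\{0,1\}$ and $\Phi^{-1}(1)=+\infty$)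 and, for $\alpha\in[0,1]$, $u\ge 0$, $$G(\alpha,u)=2-\Phi\big(\Phi^{-1}(1-\tfrac{\alpha}{2})+u\big)-\Phi\big(\Phi^{-1}(1-\tfrac{\alpha}{2})-u\big).$$ (1) If $s_0\le n+1$, then for all $\alpha\in[0,1]$, $\mu>0$ and $\xi\in[0,\tfrac32\sqrt{n-s_0+1}]$, $$1-\beta_i^{\rm opt}(\alpha;\mu)\ \le\ G\Big(\alpha,\frac{\mu(\sqrt{n-s_0+1}+\xi)}{\sigma}\Big)+e^{-\xi^2/8}.$$ (2) For every $\alpha\in(0,1)$ and every $\beta$ with $1-\beta\in(\alpha,1)$ there is a constant $c=c(\alpha,\beta)>0$, depending on $\alpha$ and $\beta$ only, such that for all $n\ge 1$, $p$, $1\le s_0\le p$, $i\in\{1,\dots,p\}$, $\sigma>0$ and $\mu>0$: if $1-\beta_i^{\rm opt}(\alpha;\mu)\ge 1-\beta$, then $\mu\ge c\,\sigma/\sqrt{n}$. -/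

import Mathlib

open MeasureTheory ProbabilityTheory

namespace GaussianDesign

noncomputable section

/-- The CDF `Φ` of the standard normal distribution, extended to the extended reals:
`Φ(x)` is the standard Gaussian measure of `{t : t ≤ x}`, so `Φ(-∞) = 0` and `Φ(+∞) = 1`. -/
def Phi (x : EReal) : ℝ :=
  (gaussianReal 0 1).real {t : ℝ | (t : EReal) ≤ x}

/-- The inverse `Φ⁻¹` on `[0,1]`, with values in the extended reals
(so `Φ⁻¹(0) = -∞` and `Φ⁻¹(1) = +∞`). -/
def PhiInv (q : ℝ) : EReal :=
  sInf {x : EReal | q ≤ Phi x}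

/-- `G(α,u) = 2 - Φ(Φ⁻¹(1 - α/2) + u) - Φ(Φ⁻¹(1 - α/2) - u)`. -/
def G (α u : ℝ) : ℝ :=
  2 - Phi (PhiInv (1 - α / 2) + (u : EReal)) - Phi (PhiInv (1 - α / 2) - (u : EReal))

/-- The law of the standard Gaussian design: the `n` rows are independent `N(0, I_p)` vectors,
that is, all entries are independent standard Gaussians. -/
def designLaw (n p : ℕ) : Measure (Fin n → Fin p → ℝ) :=
  Measure.pi fun _ => Measure.pi fun _ => gaussianReal 0 1

/-- The law `N(0, σ² I_n)` of the noise vector `w`. -/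
def noiseLaw (n : ℕ) (σ : ℝ) : Measure (Fin n → ℝ) :=
  Measure.pi fun _ => gaussianReal 0 (Real.toNNReal (σ ^ 2))

/-- The law `ℙ_θ` of the data `(y, X)`, where `y = X θ + w`, the design `X` is standard Gaussian and
the noise `w ∼ N(0, σ² I_n)` is independent of `X`. -/
def dataLaw (n p : ℕ) (σ : ℝ) (θ : Fin p → ℝ) :
    Measure ((Fin n → ℝ) × (Fin n → Fin p → ℝ)) :=
  ((designLaw n p).prod (noiseLaw n σ)).map
    fun z => ((Matrix.of z.1).mulVec θ + z.2, z.1)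

/-- A randomized test: a measurable `{0,1}`-valued function of the response `y`, the design `X` and
a further random seed in `[0,1]`; the value `true` means that the null hypothesis is rejected. -/
structure RandomizedTest (n p : ℕ) where
  decision : (Fin n → ℝ) × (Fin n → Fin p → ℝ) → unitInterval → Bool
  measurable_decision : Measurable fun z :
    ((Fin n → ℝ) × (Fin n → Fin p → ℝ)) × unitInterval => decision z.1 z.2

/-- `ℙ_θ(T = b)`, where the seed is uniform on `[0,1]` and independent of the data. -/
def decisionProb {n p : ℕ} (σ : ℝ) (T : RandomizedTest n p) (θ : Fin p → ℝ) (b : Bool) : ℝ :=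
  ((dataLaw n p σ θ).prod (volume : Measure unitInterval)).real {z | T.decision z.1 z.2 = b}

/-- The null parameters: `‖θ‖₀ ≤ s₀` and `θ_i = 0`. -/
def Omega0 {p : ℕ} (s₀ : ℕ) (i : Fin p) : Set (Fin p → ℝ) :=
  {θ | hammingNorm θ ≤ s₀ ∧ θ i = 0}

/-- The alternative parameters: `‖θ‖₀ ≤ s₀` and `|θ_i| ≥ μ`. -/
def Omega1 {p : ℕ} (s₀ : ℕ) (i : Fin p) (μ : ℝ) : Set (Fin p → ℝ) :=
  {θ | hammingNorm θ ≤ s₀ ∧ μ ≤ |θ i|}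

/-- The worst-case type I error probability `α_i(T)`. -/
def typeIError {n p : ℕ} (σ : ℝ) (s₀ : ℕ) (i : Fin p) (T : RandomizedTest n p) : ℝ :=
  sSup ((fun θ => decisionProb σ T θ true) '' Omega0 s₀ i)

/-- The worst-case type II error probability `β_i(T;μ)`. -/
def typeIIError {n p : ℕ} (σ : ℝ) (s₀ : ℕ) (i : Fin p) (μ : ℝ) (T : RandomizedTest n p) : ℝ :=
  sSup ((fun θ => decisionProb σ T θ false) '' Omega1 s₀ i μ)

/-- The minimax power `1 - β_i^opt(α;μ)`: the supremum of `1 - β_i(T;μ)` over all randomized tests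
`T` with `α_i(T) ≤ α`. -/
def minimaxPower (n : ℕ) {p : ℕ} (σ : ℝ) (s₀ : ℕ) (i : Fin p) (α μ : ℝ) : ℝ :=
  sSup ((fun T : RandomizedTest n p => 1 - typeIIError σ s₀ i μ T) ''
    {T | typeIError σ s₀ i T ≤ α})

end

end GaussianDesign

namespace GaussianDesign

open scoped Matrix ENNReal

/-! Put independent `N(0, τ²)` priors on `k` nuisance coordinates `e` other than `i`, and give
coordinate `i` the values `μ` and `-μ`. A worst-case guarantee also holds on average over the prior,
so it suffices to bound the Bayes power of a test of `θ_i = 0` against the symmetric pair `θ_i =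
±μ`.

Fix the design, let `A` be its nuisance columns and `v` its column `i`. Write `v = A * coefficient +
residual`. The part of the shift `±μ v` inside the column span merely translates the prior, at a
cost that tends to 0 as `τ → ∞` (`integral_comp_add_stdPi_le`, `integral_designMean_le`). What
remains is the shift of a Gaussian vector by `±μ` times the residual. For this pair of means,
Neyman–Pearson gives the power of the two-sided test (`average_shift_le`). It is kept in Lagrangian
form, power at most `l * level + C`, with `l` and `C` independent of the design and the nuisance
values. Being linear in the test, this form survives averaging over both.

The residual is the projection of a standard Gaussian vector on a space of dimension `n - k`, so its
norm is at least `√(n - k) + ξ` with probability at most `exp (-ξ² / 2)`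
(`designLaw_residual_tail_le`). `power_le` collects these facts. With `k = s₀ - 1` this is claim
(1), with a better exponent than required. Claim (2) uses `k = 0` together with the Lipschitz bound
that the power exceeds the level by at most the shift. -/

/-- The standard Gaussian measure on `ι → ℝ`. -/
noncomputable abbrev stdPi (ι : Type*) [Fintype ι] : Measure (ι → ℝ) :=
  Measure.pi fun _ => gaussianReal 0 1

/-! ### Translates of the standard Gaussian measure -/

section CameronMartin

variable {ι : Type*} [Fintype ι]

/-- The density at `w` of the standard Gaussian measure translated by `a`. -/
noncomputable def shiftDensity (a w : ι → ℝ) : ℝ :=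
  Real.exp (a ⬝ᵥ w - a ⬝ᵥ a / 2)

lemma shiftDensity_pos (a w : ι → ℝ) : 0 < shiftDensity a w := Real.exp_pos _

lemma continuous_dotProduct_right (a : ι → ℝ) : Continuous fun w : ι → ℝ => a ⬝ᵥ w := by
  unfold dotProduct; fun_prop

lemma continuous_shiftDensity (a : ι → ℝ) : Continuous (shiftDensity a) := by
  unfold shiftDensity
  have := continuous_dotProduct_right a
  fun_prop

lemma gaussianReal_eq_withDensity (a : ℝ) :
    gaussianReal a 1 = (gaussianReal 0 1).withDensity
      (fun x => ENNReal.ofReal (Real.exp (a * x - a * a / 2))) := by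
  rw [gaussianReal_of_var_ne_zero a one_ne_zero, gaussianReal_of_var_ne_zero 0 one_ne_zero,
    ← withDensity_mul _ (measurable_gaussianPDF 0 1) (by fun_prop)]
  congr 1
  ext x
  rw [Pi.mul_apply, gaussianPDF, gaussianPDF, ← ENNReal.ofReal_mul (gaussianPDFReal_nonneg _ _ _)]
  congr 1
  simp only [gaussianPDFReal]
  conv_rhs => rw [mul_assoc, ← Real.exp_add]
  congr 2
  simp
  ring

lemma pi_gaussianReal_eq_withDensity (a : ι → ℝ) :
    (Measure.pi fun i => gaussianReal (a i) 1) =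
      (stdPi ι).withDensity fun w => ENNReal.ofReal (shiftDensity a w) := by
  classical
  refine Measure.pi_eq fun s hs => ?_
  rw [withDensity_apply _ (MeasurableSet.univ_pi hs), ← lintegral_indicator (.univ_pi hs)]
  have key : ∀ w : ι → ℝ, (Set.univ.pi s).indicator (fun w => ENNReal.ofReal (shiftDensity a w)) w
      = ∏ i, (s i).indicator
        (fun x => ENNReal.ofReal (Real.exp (a i * x - a i * a i / 2))) (w i) := by
    intro w
    by_cases hw : w ∈ Set.univ.pi s
    · rw [Set.indicator_of_mem hw]
      have : ∀ i, w i ∈ s i := fun i => hw i (Set.mem_univ i)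
      simp_rw [Set.indicator_of_mem (this _)]
      rw [← ENNReal.ofReal_prod_of_nonneg (fun _ _ => (Real.exp_pos _).le), ← Real.exp_sum]
      simp [shiftDensity, dotProduct, Finset.sum_sub_distrib, Finset.sum_div]
    · rw [Set.indicator_of_notMem hw]
      simp only [Set.mem_pi, Set.mem_univ, true_implies, not_forall] at hw
      obtain ⟨i, hi⟩ := hw
      exact (Finset.prod_eq_zero (Finset.mem_univ i) (Set.indicator_of_notMem hi _)).symm
  simp_rw [key]
  have meas : ∀ i, Measurable ((s i).indicator
      (fun x : ℝ => ENNReal.ofReal (Real.exp (a i * x - a i * a i / 2)))) := fun i =>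
    Measurable.indicator (by fun_prop) (hs i)
  have := lintegral_prod_eq_prod_lintegral_of_indepFun (μ := stdPi ι) Finset.univ _
    (iIndepFun_pi (μ := fun _ : ι => gaussianReal 0 1) fun i => (meas i).aemeasurable)
    (fun i => (meas i).comp (measurable_pi_apply i))
  rw [this]
  refine Finset.prod_congr rfl fun i _ => ?_
  have h2 := (measurePreserving_eval (fun _ : ι => gaussianReal 0 1) i).lintegral_comp (meas i)
  simp only [Function.eval] at h2
  rw [h2, lintegral_indicator (hs i), ← withDensity_apply _ (hs i), ← gaussianReal_eq_withDensity]

lemma stdPi_map_add (a : ι → ℝ) :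
    (stdPi ι).map (fun w => w + a) =
      (stdPi ι).withDensity fun w => ENNReal.ofReal (shiftDensity a w) := by
  rw [← pi_gaussianReal_eq_withDensity]
  have h : ∀ i, (gaussianReal 0 1).map (fun x => x + a i) = gaussianReal (a i) 1 := fun i => by
    rw [gaussianReal_map_add_const, zero_add]
  have := Measure.pi_map_pi (μ := fun _ : ι => gaussianReal 0 1) (f := fun i x => x + a i)
    (hμ := fun i => by rw [h]; infer_instance) (fun i => by fun_prop)
  simp_rw [h] at this
  exact this

/-- **Cameron–Martin formula** for the standard Gaussian measure. -/
lemma integral_comp_add_stdPi (a : ι → ℝ) {f : (ι → ℝ) → ℝ} (hf : Measurable f) :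
    ∫ w, f (w + a) ∂(stdPi ι) = ∫ w, shiftDensity a w * f w ∂(stdPi ι) := by
  have h1 : ∫ w, f (w + a) ∂(stdPi ι) = ∫ w, f w ∂((stdPi ι).map fun w => w + a) :=
    (integral_map (by fun_prop) hf.aestronglyMeasurable).symm
  rw [h1, stdPi_map_add, integral_withDensity_eq_integral_toReal_smul
    (continuous_shiftDensity a).measurable.ennreal_ofReal (by simp)]
  simp [ENNReal.toReal_ofReal (shiftDensity_pos a _).le]

lemma integrable_shiftDensity (a : ι → ℝ) : Integrable (shiftDensity a) (stdPi ι) := by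
  have h : IsProbabilityMeasure
      ((stdPi ι).withDensity fun w => ENNReal.ofReal (shiftDensity a w)) := by
    rw [← pi_gaussianReal_eq_withDensity]; infer_instance
  refine ⟨(continuous_shiftDensity a).aestronglyMeasurable, ?_⟩
  rw [hasFiniteIntegral_iff_ofReal (.of_forall fun w => (shiftDensity_pos a w).le)]
  have := h.measure_univ
  rw [withDensity_apply _ .univ, setLIntegral_univ] at this
  simp [this]

lemma integral_shiftDensity (a : ι → ℝ) : ∫ w, shiftDensity a w ∂(stdPi ι) = 1 := by
  simpa using (integral_comp_add_stdPi a (f := fun _ => 1) measurable_const).symm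

lemma shiftDensity_sq (a w : ι → ℝ) :
    shiftDensity a w ^ 2 = Real.exp (a ⬝ᵥ a) * shiftDensity (a + a) w := by
  simp only [shiftDensity, ← Real.exp_nat_mul, ← Real.exp_add, dotProduct_add, add_dotProduct]
  congr 1
  push_cast
  ring

lemma dotProduct_self_nonneg_real (a : ι → ℝ) : 0 ≤ a ⬝ᵥ a :=
  Finset.sum_nonneg fun i _ => mul_self_nonneg (a i)

/-- Both laws have the same characteristic function, which factorizes over the coordinates. This
reduces the testing problem to one dimension. -/
lemma stdPi_map_dotProduct (a : ι → ℝ) :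
    (stdPi ι).map (fun w => a ⬝ᵥ w) =
      (gaussianReal 0 1).map (fun z => Real.sqrt (a ⬝ᵥ a) * z) := by
  have : IsProbabilityMeasure ((stdPi ι).map (fun w => a ⬝ᵥ w)) :=
    Measure.isProbabilityMeasure_map (continuous_dotProduct_right a).aemeasurable
  have : IsProbabilityMeasure ((gaussianReal 0 1).map (fun z => Real.sqrt (a ⬝ᵥ a) * z)) :=
    Measure.isProbabilityMeasure_map (by fun_prop)
  refine Measure.ext_of_charFun ?_
  ext t
  rw [gaussianReal_map_const_mul, charFun_gaussianReal, charFun_apply_real,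
    integral_map (continuous_dotProduct_right a).aemeasurable (by fun_prop)]
  have : ∀ w : ι → ℝ, Complex.exp (t * (a ⬝ᵥ w : ℝ) * Complex.I) =
      ∏ i, Complex.exp ((t * a i : ℝ) * w i * Complex.I) := by
    intro w
    rw [← Complex.exp_sum]
    congr 1
    simp only [dotProduct, Complex.ofReal_sum, Complex.ofReal_mul, Finset.mul_sum, Finset.sum_mul]
    exact Finset.sum_congr rfl fun i _ => by ring
  simp_rw [this]
  rw [integral_fintype_prod_eq_prod
    (f := fun i (x : ℝ) => Complex.exp ((t * a i : ℝ) * x * Complex.I))]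
  simp_rw [← charFun_apply_real, charFun_gaussianReal, ← Complex.exp_sum]
  congr 1
  have hs : Real.sqrt (a ⬝ᵥ a) ^ 2 = a ⬝ᵥ a := Real.sq_sqrt (dotProduct_self_nonneg_real a)
  simp only [mul_zero, Complex.ofReal_zero, zero_mul, NNReal.coe_mul, NNReal.coe_mk, hs]
  simp only [dotProduct, Complex.ofReal_mul, Complex.ofReal_sum, zero_sub, NNReal.coe_one,
    Complex.ofReal_one, mul_one, one_mul, Finset.sum_neg_distrib, Finset.sum_mul, Finset.sum_div]
  congr 1
  exact Finset.sum_congr rfl fun i _ => by ring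

/-- Translating the standard Gaussian measure by `a` changes the mean of a `[0,1]`-valued function
by at most `√(exp |a|² - 1)`. -/
lemma integral_comp_add_stdPi_le (a : ι → ℝ) {f : (ι → ℝ) → ℝ} (hf : Measurable f)
    (h0 : ∀ w, 0 ≤ f w) (h1 : ∀ w, f w ≤ 1) :
    ∫ w, f (w + a) ∂(stdPi ι) ≤ ∫ w, f w ∂(stdPi ι) + Real.sqrt (Real.exp (a ⬝ᵥ a) - 1) := by
  have hfi : Integrable f (stdPi ι) := by
    refine Integrable.of_bound hf.aestronglyMeasurable 1 (.of_forall fun w => ?_)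
    rw [Real.norm_eq_abs, abs_of_nonneg (h0 w)]; exact h1 w
  have hMf : Integrable (fun w => shiftDensity a w * f w) (stdPi ι) := by
    refine (integrable_shiftDensity a).mono
      ((continuous_shiftDensity a).measurable.mul hf).aestronglyMeasurable (.of_forall fun w => ?_)
    rw [norm_mul, Real.norm_eq_abs (f w), abs_of_nonneg (h0 w)]
    exact mul_le_of_le_one_right (norm_nonneg _) (h1 w)
  rw [integral_comp_add_stdPi a hf]
  set S := Real.exp (a ⬝ᵥ a) - 1
  -- The case `a = 0` is separate because `η` below appears in denominators.
  rcases eq_or_lt_of_le (dotProduct_self_nonneg_real a) with h | h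
  · have : a = 0 := dotProduct_self_eq_zero.1 h.symm
    subst this
    have : ∫ w, shiftDensity (0 : ι → ℝ) w * f w ∂(stdPi ι) = ∫ w, f w ∂(stdPi ι) := by
      simp [shiftDensity]
    rw [this]
    exact le_add_of_nonneg_right (Real.sqrt_nonneg _)
  have hS : 0 < S := by
    have := Real.add_one_lt_exp h.ne'
    simp only [S]; linarith
  set η := Real.sqrt S
  have hη : 0 < η := Real.sqrt_pos.2 hS
  have hηS : η ^ 2 = S := Real.sq_sqrt hS.le
  have hM1 := integrable_shiftDensity a
  have hM2 := (integrable_shiftDensity (a + a)).const_mul (Real.exp (a ⬝ᵥ a))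
  have hsqi : Integrable (fun w => Real.exp (a ⬝ᵥ a) * shiftDensity (a + a) w
      - 2 * shiftDensity a w + 1) (stdPi ι) :=
    (hM2.sub (hM1.const_mul 2)).add (integrable_const 1)
  -- With `M` the density, `(M - 1) * f ≤ max (M - 1) 0 ≤ η / 2 + (M - 1)² / (2η)` by AM-GM. Since
  -- `(M - 1)²` has mean `S = η²`, this choice of `η` makes the error integrate to exactly `η`.
  have hpt : ∀ w, shiftDensity a w * f w ≤ f w + (η / 2 + (1 / (2 * η)) *
      (Real.exp (a ⬝ᵥ a) * shiftDensity (a + a) w - 2 * shiftDensity a w + 1)) := by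
    intro w
    rw [← shiftDensity_sq]
    set M := shiftDensity a w
    have e : η / 2 + 1 / (2 * η) * (M ^ 2 - 2 * M + 1) - (M - 1) =
        ((M - 1 - η) ^ 2) / (2 * η) := by field_simp; ring
    have e2 : 0 ≤ η / 2 + 1 / (2 * η) * (M ^ 2 - 2 * M + 1) := by
      have : 0 ≤ M ^ 2 - 2 * M + 1 := by nlinarith [sq_nonneg (M - 1)]
      positivity
    have e3 : 0 ≤ ((M - 1 - η) ^ 2) / (2 * η) := by positivity
    rcases le_total M 1 with hM | hM
    · nlinarith [h0 w]
    · nlinarith [h1 w]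
  calc ∫ w, shiftDensity a w * f w ∂(stdPi ι)
      ≤ ∫ w, (f w + (η / 2 + (1 / (2 * η)) *
        (Real.exp (a ⬝ᵥ a) * shiftDensity (a + a) w - 2 * shiftDensity a w + 1))) ∂(stdPi ι) :=
        integral_mono hMf (hfi.add ((integrable_const _).add (hsqi.const_mul _))) hpt
    _ = ∫ w, f w ∂(stdPi ι) + η := by
        have i1 : Integrable (fun w => η / 2 + (1 / (2 * η)) * (Real.exp (a ⬝ᵥ a) *
            shiftDensity (a + a) w - 2 * shiftDensity a w + 1)) (stdPi ι) :=
          (integrable_const _).add (hsqi.const_mul _)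
        have i2 : Integrable (fun w => Real.exp (a ⬝ᵥ a) *
            shiftDensity (a + a) w - 2 * shiftDensity a w) (stdPi ι) := hM2.sub (hM1.const_mul 2)
        rw [integral_add hfi i1, integral_add (integrable_const _) (hsqi.const_mul _),
          integral_const_mul, integral_add i2 (integrable_const 1),
          integral_sub hM2 (hM1.const_mul 2), integral_const_mul, integral_const_mul,
          integral_shiftDensity, integral_shiftDensity]
        have : Real.exp (a ⬝ᵥ a) = η ^ 2 + 1 := by rw [hηS]; simp [S]
        simp only [integral_const, probReal_univ, smul_eq_mul, this]
        field_simp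
        ring

end CameronMartin

/-! ### Neyman–Pearson theory for the two-sided test -/

section TwoSided

/-- The probability that a normal variable with mean `u` and variance `1` exceeds `c` in absolute
value, which is the power of the two-sided test with threshold `c` against the shift `u`. -/
noncomputable def twoSidedPower (c u : ℝ) : ℝ :=
  (gaussianReal u 1).real {z | c < |z|}

/-- The likelihood ratio of the symmetric mixture of `N(±u, 1)` with respect to `N(0, 1)`. -/
noncomputable def mixtureRatio (u z : ℝ) : ℝ :=
  Real.exp (-u ^ 2 / 2) * Real.cosh (u * z)

lemma measurableSet_lt_abs (c : ℝ) : MeasurableSet {z : ℝ | c < |z|} :=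
  measurableSet_lt measurable_const measurable_norm

lemma measureReal_gaussianReal_eq_setIntegral (a : ℝ) {s : Set ℝ} (hs : MeasurableSet s) :
    (gaussianReal a 1).real s = ∫ z in s, Real.exp (a * z - a * a / 2) ∂(gaussianReal 0 1) := by
  rw [measureReal_def, gaussianReal_eq_withDensity, withDensity_apply _ hs,
    integral_eq_lintegral_of_nonneg_ae (.of_forall fun _ => (Real.exp_pos _).le) (by fun_prop)]

lemma integrable_exp_shift (a : ℝ) :
    Integrable (fun z => Real.exp (a * z - a * a / 2)) (gaussianReal 0 1) := by
  have := (integrable_exp_mul_gaussianReal (μ := 0) (v := 1) a).mul_const (Real.exp (-(a * a / 2)))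
  refine this.congr (.of_forall fun z => ?_)
  simp only
  rw [← Real.exp_add, sub_eq_add_neg]

lemma mixtureRatio_eq (u z : ℝ) : mixtureRatio u z =
    (1 / 2) * Real.exp (u * z - u * u / 2) + (1 / 2) * Real.exp (-u * z - -u * -u / 2) := by
  rw [mixtureRatio, Real.cosh_eq, sub_eq_add_neg, sub_eq_add_neg, Real.exp_add, Real.exp_add]
  have h1 : -u ^ 2 / 2 = -(u * u / 2) := by ring
  have h2 : -(-u * -u / 2) = -(u * u / 2) := by ring
  have h3 : -u * z = -(u * z) := by ring
  rw [h1, h2, h3]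
  ring

lemma integrable_mixtureRatio (u : ℝ) : Integrable (mixtureRatio u) (gaussianReal 0 1) := by
  rw [funext (mixtureRatio_eq u)]
  exact ((integrable_exp_shift u).const_mul _).add ((integrable_exp_shift (-u)).const_mul _)

lemma continuous_mixtureRatio (u : ℝ) : Continuous (mixtureRatio u) := by
  unfold mixtureRatio; fun_prop

lemma mixtureRatio_le_of_abs_le {u z d : ℝ} (h : |z| ≤ |d|) : mixtureRatio u z ≤ mixtureRatio u d := by
  refine mul_le_mul_of_nonneg_left ?_ (Real.exp_pos _).le
  rw [Real.cosh_le_cosh, abs_mul, abs_mul]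
  exact mul_le_mul_of_nonneg_left h (abs_nonneg u)

lemma twoSidedPower_neg (c u : ℝ) : twoSidedPower c (-u) = twoSidedPower c u := by
  unfold twoSidedPower
  rw [← gaussianReal_map_neg, map_measureReal_apply measurable_neg (measurableSet_lt_abs c)]
  simp

lemma setIntegral_mixtureRatio (d u : ℝ) :
    ∫ z in {z | d < |z|}, mixtureRatio u z ∂(gaussianReal 0 1) = twoSidedPower d u := by
  have hs := measurableSet_lt_abs d
  simp_rw [mixtureRatio_eq]
  rw [integral_add ((integrable_exp_shift u).const_mul _).integrableOn
      ((integrable_exp_shift (-u)).const_mul _).integrableOn, integral_const_mul,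
    integral_const_mul, ← measureReal_gaussianReal_eq_setIntegral u hs,
    ← measureReal_gaussianReal_eq_setIntegral (-u) hs]
  change 1 / 2 * twoSidedPower d u + 1 / 2 * twoSidedPower d (-u) = _
  rw [twoSidedPower_neg]
  ring

lemma twoSidedPower_nonneg (c u : ℝ) : 0 ≤ twoSidedPower c u := measureReal_nonneg

/-- The distribution function of the standard normal law at real arguments. -/
noncomputable def stdCDF (x : ℝ) : ℝ := (gaussianReal 0 1).real (Set.Iic x)

instance nullSingletonClass_gaussianReal_one (u : ℝ) : NullSingletonClass (gaussianReal u 1) :=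
  nullSingletonClass_gaussianReal one_ne_zero

lemma measureReal_gaussianReal_Iic (u x : ℝ) :
    (gaussianReal u 1).real (Set.Iic x) = stdCDF (x - u) := by
  rw [stdCDF, ← zero_add u, ← gaussianReal_map_add_const,
    map_measureReal_apply (by fun_prop) measurableSet_Iic]
  congr 1
  ext z
  simp [le_sub_iff_add_le]

lemma measureReal_gaussianReal_Iio (u x : ℝ) :
    (gaussianReal u 1).real (Set.Iio x) = stdCDF (x - u) := by
  rw [← measureReal_gaussianReal_Iic]
  exact measureReal_congr Iio_ae_eq_Iic

lemma stdCDF_neg (x : ℝ) : stdCDF (-x) = 1 - stdCDF x := by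
  have h := measureReal_gaussianReal_Iio 0 x
  rw [sub_zero] at h
  rw [← h, ← probReal_compl_eq_one_sub measurableSet_Iio, Set.compl_Iio, stdCDF]
  have h2 : (gaussianReal 0 1).map (fun x => -x) = gaussianReal 0 1 := by
    rw [gaussianReal_map_neg, neg_zero]
  conv_lhs => rw [← h2]
  rw [map_measureReal_apply measurable_neg measurableSet_Iic]
  congr 1
  ext z
  simp

lemma twoSidedPower_eq {c : ℝ} (hc : 0 ≤ c) (u : ℝ) :
    twoSidedPower c u = 2 - stdCDF (c + u) - stdCDF (c - u) := by
  have h : {z : ℝ | c < |z|} = Set.Iio (-c) ∪ (Set.Iic c)ᶜ := by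
    ext z
    simp only [Set.mem_ofPred_eq, Set.mem_union, Set.mem_Iio, Set.compl_Iic, Set.mem_Ioi, lt_abs]
    constructor
    · rintro (h | h)
      · exact Or.inr h
      · exact Or.inl (by linarith)
    · rintro (h | h)
      · exact Or.inr (by linarith)
      · exact Or.inl h
  rw [twoSidedPower, h, measureReal_union _ measurableSet_Iic.compl,
    probReal_compl_eq_one_sub measurableSet_Iic, measureReal_gaussianReal_Iio,
    measureReal_gaussianReal_Iic, show -c - u = -(c + u) by ring, stdCDF_neg]
  · ring
  · rw [Set.disjoint_left]
    intro z hz hz'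
    simp only [Set.mem_Iio, Set.compl_Iic, Set.mem_Ioi] at hz hz'
    linarith

lemma twoSidedPower_zero {c : ℝ} (hc : 0 ≤ c) : twoSidedPower c 0 = 2 * (1 - stdCDF c) := by
  rw [twoSidedPower_eq hc, add_zero, sub_zero]; ring

lemma stdCDF_add_sub (x u u' : ℝ) (h : u ≤ u') :
    stdCDF (u' + x) - stdCDF (u + x) = (gaussianReal (-x) 1).real (Set.Ioc u u') := by
  have e : ∀ v : ℝ, stdCDF (v + x) = (gaussianReal (-x) 1).real (Set.Iic v) := fun v => by
    rw [measureReal_gaussianReal_Iic, sub_neg_eq_add]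
  rw [e, e, ← Set.Iic_sdiff_Iic, measureReal_sdiff (Set.Iic_subset_Iic.2 h) measurableSet_Iic]

/-- The increment of the power from `u` to `u'` is the difference of the masses that `N(c,1)` and
`N(-c,1)` give to `(u, u']`. On the positive half-line the density of the former is larger. -/
lemma twoSidedPower_mono {c u u' : ℝ} (hc : 0 ≤ c) (hu : 0 ≤ u) (h : u ≤ u') :
    twoSidedPower c u ≤ twoSidedPower c u' := by
  have e1 := stdCDF_add_sub c u u' h
  have e2 := stdCDF_add_sub (-c) u u' h
  rw [neg_neg, ← sub_eq_add_neg, ← sub_eq_add_neg] at e2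
  have h3 : (gaussianReal (-c) 1).real (Set.Ioc u u') ≤ (gaussianReal c 1).real (Set.Ioc u u') := by
    rw [measureReal_gaussianReal_eq_setIntegral _ measurableSet_Ioc,
      measureReal_gaussianReal_eq_setIntegral _ measurableSet_Ioc]
    refine setIntegral_mono_on (integrable_exp_shift _).integrableOn
      (integrable_exp_shift _).integrableOn measurableSet_Ioc fun z hz => ?_
    refine Real.exp_le_exp.2 ?_
    have : 0 ≤ z := hu.trans hz.1.le
    nlinarith [mul_nonneg hc this]
  rw [twoSidedPower_eq hc, twoSidedPower_eq hc, ← neg_sub u c, ← neg_sub u' c, stdCDF_neg,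
    stdCDF_neg, add_comm c, add_comm c]
  linarith

lemma setIntegral_mixtureRatio_sub (d u l : ℝ) :
    ∫ z in {z | d < |z|}, (mixtureRatio u z - l) ∂(gaussianReal 0 1) =
      twoSidedPower d u - l * twoSidedPower d 0 := by
  rw [integral_sub (integrable_mixtureRatio u).integrableOn (integrable_const l),
    setIntegral_mixtureRatio, setIntegral_const, twoSidedPower, twoSidedPower, smul_eq_mul,
    mul_comm]

/-- The left side is the best Lagrangian value of a test against shift `u`. The ratio is even and
increasing in `|z|`, so the optimum is a two-sided test with some threshold `d`. Raising `u` to `u₀`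
increases its power, and at `u₀` the threshold `c` is optimal for the multiplier `l`. -/
lemma integral_posPart_mixtureRatio_le {c u u₀ : ℝ} (hc : 0 ≤ c) (hu : 0 ≤ u) (h : u ≤ u₀) :
    ∫ z, max (mixtureRatio u z - mixtureRatio u₀ c) 0 ∂(gaussianReal 0 1) ≤
      twoSidedPower c u₀ - mixtureRatio u₀ c * twoSidedPower c 0 := by
  set l := mixtureRatio u₀ c
  have hint : ∀ v, Integrable (fun z => mixtureRatio v z - l) (gaussianReal 0 1) := fun v =>
    (integrable_mixtureRatio v).sub (integrable_const l)
  have hpos : ∀ v, Integrable (fun z => max (mixtureRatio v z - l) 0) (gaussianReal 0 1) :=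
    fun v => (hint v).pos_part
  have hub : ∀ d, ∫ z in {z | d < |z|}, (mixtureRatio u₀ z - l) ∂(gaussianReal 0 1) ≤
      ∫ z in {z | c < |z|}, (mixtureRatio u₀ z - l) ∂(gaussianReal 0 1) := by
    intro d
    rw [← integral_indicator (measurableSet_lt_abs d), ← integral_indicator (measurableSet_lt_abs c)]
    refine integral_mono ((hint u₀).indicator (measurableSet_lt_abs d))
      ((hint u₀).indicator (measurableSet_lt_abs c)) fun z => ?_
    have hcase : (c < |z| → 0 ≤ mixtureRatio u₀ z - l) ∧ (|z| ≤ c → mixtureRatio u₀ z - l ≤ 0) := by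
      refine ⟨fun hz => sub_nonneg.2 (mixtureRatio_le_of_abs_le ?_),
        fun hz => sub_nonpos.2 (mixtureRatio_le_of_abs_le ?_)⟩
      · rw [abs_of_nonneg hc]; exact hz.le
      · rwa [abs_of_nonneg hc]
    by_cases h1 : c < |z| <;> by_cases h2 : d < |z| <;>
      simp only [Set.indicator, Set.mem_ofPred_eq, h1, h2, if_true, if_false, le_refl]
    · exact hcase.1 h1
    · exact hcase.2 (not_lt.1 h1)
  rw [← setIntegral_mixtureRatio_sub]
  by_cases hall : ∀ z, mixtureRatio u z ≤ l
  · have : ∀ z, max (mixtureRatio u z - l) 0 = 0 := fun z => max_eq_right (sub_nonpos.2 (hall z))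
    simp_rw [this, integral_zero]
    refine setIntegral_nonneg (measurableSet_lt_abs c) fun z hz => ?_
    refine sub_nonneg.2 (mixtureRatio_le_of_abs_le ?_)
    rw [abs_of_nonneg hc]; exact le_of_lt hz
  push Not at hall
  obtain ⟨z₀, hz₀⟩ := hall
  -- The threshold `d` solves `mixtureRatio u d = l`, or is 0 if the ratio is at least `l`
  -- everywhere. In that case the single point `z = 0` escapes, which is a null set.
  obtain ⟨d, hd, hd1, hd2⟩ : ∃ d, 0 ≤ d ∧ (∀ z, d < |z| → l ≤ mixtureRatio u z) ∧
      (∀ z, |z| ≤ d → mixtureRatio u z ≤ l ∨ z = 0) := by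
    rcases le_total l (mixtureRatio u 0) with h0 | h0
    · refine ⟨0, le_rfl, fun z _ => h0.trans (mixtureRatio_le_of_abs_le (by simp)), fun z hz => ?_⟩
      exact Or.inr (abs_nonpos_iff.1 hz)
    · have hz1 : l ≤ mixtureRatio u |z₀| := hz₀.le.trans (mixtureRatio_le_of_abs_le (by simp))
      obtain ⟨d, hd, hde⟩ := intermediate_value_Icc (abs_nonneg z₀)
        (continuous_mixtureRatio u).continuousOn ⟨h0, hz1⟩
      refine ⟨d, hd.1, fun z hz => ?_, fun z hz => Or.inl ?_⟩
      · rw [← hde]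
        refine mixtureRatio_le_of_abs_le ?_
        rw [abs_of_nonneg hd.1]; exact hz.le
      · rw [← hde]
        refine mixtureRatio_le_of_abs_le ?_
        rwa [abs_of_nonneg hd.1]
  have hne : ∀ᵐ z ∂(gaussianReal 0 1), z ≠ (0 : ℝ) := by
    rw [ae_iff]; simp
  calc ∫ z, max (mixtureRatio u z - l) 0 ∂(gaussianReal 0 1)
      = ∫ z in {z | d < |z|}, (mixtureRatio u z - l) ∂(gaussianReal 0 1) := by
        rw [← integral_indicator (measurableSet_lt_abs d)]
        refine integral_congr_ae ?_
        filter_upwards [hne] with z hz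
        by_cases hz2 : d < |z|
        · rw [Set.indicator_of_mem (by exact hz2), max_eq_left (sub_nonneg.2 (hd1 z hz2))]
        · rw [Set.indicator_of_notMem (by exact hz2)]
          rcases hd2 z (not_lt.1 hz2) with h' | h'
          · exact max_eq_right (sub_nonpos.2 h')
          · exact absurd h' hz
    _ ≤ ∫ z in {z | d < |z|}, (mixtureRatio u₀ z - l) ∂(gaussianReal 0 1) := by
        rw [setIntegral_mixtureRatio_sub, setIntegral_mixtureRatio_sub]
        linarith [twoSidedPower_mono hd hu h]
    _ ≤ _ := hub d

variable {ι : Type*} [Fintype ι]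

/-- The **Neyman–Pearson bound** in Lagrangian form for a randomized test of a standard Gaussian
vector against the symmetric mixture of its translates by `±a`. -/
lemma average_shift_le {c u₀ : ℝ} (hc : 0 ≤ c) (hu₀ : 0 ≤ u₀) (a : ι → ℝ) (ha : a ⬝ᵥ a ≤ u₀ ^ 2)
    {f : (ι → ℝ) → ℝ} (hf : Measurable f) (h0 : ∀ w, 0 ≤ f w) (h1 : ∀ w, f w ≤ 1) :
    (∫ w, f (w + a) ∂(stdPi ι) + ∫ w, f (w + -a) ∂(stdPi ι)) / 2 ≤
      mixtureRatio u₀ c * ∫ w, f w ∂(stdPi ι) +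
        (twoSidedPower c u₀ - mixtureRatio u₀ c * twoSidedPower c 0) := by
  have hfi : Integrable f (stdPi ι) := by
    refine Integrable.of_bound hf.aestronglyMeasurable 1 (.of_forall fun w => ?_)
    rw [Real.norm_eq_abs, abs_of_nonneg (h0 w)]; exact h1 w
  have hMf : ∀ b : ι → ℝ, Integrable (fun w => shiftDensity b w * f w) (stdPi ι) := fun b => by
    refine (integrable_shiftDensity b).mono
      ((continuous_shiftDensity b).measurable.mul hf).aestronglyMeasurable (.of_forall fun w => ?_)
    rw [norm_mul, Real.norm_eq_abs (f w), abs_of_nonneg (h0 w)]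
    exact mul_le_of_le_one_right (norm_nonneg _) (h1 w)
  set l := mixtureRatio u₀ c
  set u := Real.sqrt (a ⬝ᵥ a)
  have hu : u ^ 2 = a ⬝ᵥ a := Real.sq_sqrt (dotProduct_self_nonneg_real a)
  have hu1 : u ≤ u₀ := Real.sqrt_le_iff.2 ⟨hu₀, ha⟩
  have hbase := integral_posPart_mixtureRatio_le hc (Real.sqrt_nonneg (a ⬝ᵥ a)) hu1
  let K : ℝ → ℝ := fun x => max (Real.exp (-u ^ 2 / 2) * Real.cosh x - l) 0
  have hK : Continuous K := by fun_prop
  have hlaw : ∫ z, max (mixtureRatio u z - l) 0 ∂(gaussianReal 0 1) =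
      ∫ w, K (a ⬝ᵥ w) ∂(stdPi ι) := by
    have e1 := integral_map (μ := stdPi ι) (continuous_dotProduct_right a).aemeasurable
      hK.aestronglyMeasurable
    have e2 := integral_map (μ := gaussianReal 0 1) (φ := fun z => u * z) (by fun_prop)
      hK.aestronglyMeasurable
    rw [← e1, stdPi_map_dotProduct, e2]
    rfl
  have hKi : Integrable (fun w => K (a ⬝ᵥ w)) (stdPi ι) := by
    have h2 : Integrable K ((gaussianReal 0 1).map fun z => u * z) := by
      rw [integrable_map_measure hK.aestronglyMeasurable (by fun_prop)]
      exact ((integrable_mixtureRatio u).sub (integrable_const l)).pos_part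
    rw [← stdPi_map_dotProduct a] at h2
    exact (integrable_map_measure hK.aestronglyMeasurable
      (continuous_dotProduct_right a).aemeasurable).1 h2
  -- The averaged density of the two translates is a function of `a ⬝ᵥ w` alone, and `f * (ratio -
  -- l)` is at most the positive part of `ratio - l` because `0 ≤ f ≤ 1`.
  have hpt : ∀ w, (shiftDensity a w * f w + shiftDensity (-a) w * f w) / 2 ≤
      l * f w + K (a ⬝ᵥ w) := by
    intro w
    have e : (shiftDensity a w + shiftDensity (-a) w) / 2 =
        Real.exp (-u ^ 2 / 2) * Real.cosh (a ⬝ᵥ w) := by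
      rw [hu, Real.cosh_eq]
      simp only [shiftDensity, neg_dotProduct, dotProduct_neg, neg_neg, sub_eq_add_neg,
        Real.exp_add, neg_div]
      ring
    have e2 : (shiftDensity a w * f w + shiftDensity (-a) w * f w) / 2 - l * f w =
        f w * (Real.exp (-u ^ 2 / 2) * Real.cosh (a ⬝ᵥ w) - l) := by rw [← e]; ring
    have e3 : f w * (Real.exp (-u ^ 2 / 2) * Real.cosh (a ⬝ᵥ w) - l) ≤ K (a ⬝ᵥ w) := by
      refine (mul_le_mul_of_nonneg_left (le_max_left _ 0) (h0 w)).trans ?_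
      exact mul_le_of_le_one_left (le_max_right _ _) (h1 w)
    linarith
  rw [integral_comp_add_stdPi a hf, integral_comp_add_stdPi (-a) hf,
    ← integral_add (hMf a) (hMf (-a)), ← integral_div]
  refine (integral_mono (((hMf a).add (hMf (-a))).div_const 2)
    ((hfi.const_mul l).add hKi) hpt).trans ?_
  have e : ∫ w, (l * f w + K (a ⬝ᵥ w)) ∂(stdPi ι) =
      l * ∫ w, f w ∂(stdPi ι) + ∫ w, K (a ⬝ᵥ w) ∂(stdPi ι) := by
    rw [integral_add (hfi.const_mul l) hKi, integral_const_mul]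
  refine e.le.trans ?_
  rw [← hlaw]
  linarith

end TwoSided

/-! ### Upper tail of the chi-square law -/

section ChiSquare

lemma integral_exp_mul_sq_gaussianReal {s : ℝ} (hs : s < 1 / 2) :
    ∫ x, Real.exp (s * x ^ 2) ∂(gaussianReal 0 1) = (Real.sqrt (1 - 2 * s))⁻¹ := by
  rw [integral_gaussianReal_eq_integral_smul one_ne_zero]
  have : ∀ x : ℝ, gaussianPDFReal 0 1 x • Real.exp (s * x ^ 2) =
      (Real.sqrt (2 * Real.pi))⁻¹ * Real.exp (-(1 / 2 - s) * x ^ 2) := by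
    intro x
    simp only [gaussianPDFReal, NNReal.coe_one, mul_one, sub_zero, smul_eq_mul]
    rw [mul_assoc, ← Real.exp_add]
    congr 2
    ring
  simp_rw [this]
  rw [integral_const_mul, integral_gaussian, ← Real.sqrt_inv, ← Real.sqrt_mul (by positivity),
    ← Real.sqrt_inv]
  congr 1
  have h1 : 1 / 2 - s ≠ 0 := by linarith
  have h2 : 1 - 2 * s ≠ 0 := by linarith
  have := Real.pi_ne_zero
  field_simp

lemma integral_exp_mul_sum_sq {m : ℕ} {s : ℝ} (hs : s < 1 / 2) :
    ∫ x : Fin m → ℝ, Real.exp (s * ∑ j, x j ^ 2) ∂(stdPi (Fin m)) =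
      (Real.sqrt (1 - 2 * s))⁻¹ ^ m := by
  have : ∀ x : Fin m → ℝ, Real.exp (s * ∑ j, x j ^ 2) = ∏ j, Real.exp (s * x j ^ 2) := by
    intro x; rw [← Real.exp_sum, Finset.mul_sum]
  simp_rw [this]
  rw [integral_fintype_prod_eq_pow (fun x : ℝ => Real.exp (s * x ^ 2)),
    integral_exp_mul_sq_gaussianReal hs, Fintype.card_fin]

/-- A Chernoff bound for the upper tail of the `χ²` distribution with `m` degrees of freedom. -/
lemma chiSquare_tail_le {m : ℕ} (hm : 0 < m) {ξ : ℝ} (hξ : 0 ≤ ξ) :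
    (stdPi (Fin m)).real {x | (Real.sqrt m + ξ) ^ 2 ≤ ∑ j, x j ^ 2} ≤ Real.exp (-ξ ^ 2 / 2) := by
  have hm' : 0 < Real.sqrt m := Real.sqrt_pos.2 (by exact_mod_cast hm)
  have hsq : Real.sqrt m ^ 2 = m := Real.sq_sqrt (by positivity)
  set r := Real.sqrt m
  set y := ξ / r
  have hy : 0 ≤ y := by positivity
  have hξy : ξ = r * y := by simp only [y]; field_simp
  -- This is the optimal Chernoff parameter, where `1 - 2s = m / (√m + ξ)²`.
  set s := (1 - 1 / (1 + y) ^ 2) / 2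
  have h12 : 1 - 2 * s = ((1 + y)⁻¹) ^ 2 := by simp only [s]; field_simp; ring
  have hinv : 0 < (1 + y)⁻¹ := by positivity
  have hs : s < 1 / 2 := by nlinarith [pow_pos hinv 2]
  have hs0 : 0 ≤ s := by
    have : (1 + y)⁻¹ ≤ 1 := inv_le_one_of_one_le₀ (by linarith)
    nlinarith
  have hval := integral_exp_mul_sum_sq (m := m) hs
  rw [h12, Real.sqrt_sq hinv.le, inv_inv] at hval
  -- A non-integrable function has Bochner integral 0, so the nonzero value just computed gives
  -- integrability.
  have hint : Integrable (fun x : Fin m → ℝ => Real.exp (s * ∑ j, x j ^ 2)) (stdPi (Fin m)) :=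
    Integrable.of_integral_ne_zero (by rw [hval]; positivity)
  refine (measure_ge_le_exp_mul_mgf _ hs0 hint).trans ?_
  rw [mgf, hval]
  calc Real.exp (-s * (r + ξ) ^ 2) * (1 + y) ^ m
      ≤ Real.exp (-s * (r + ξ) ^ 2) * Real.exp y ^ m := by
        gcongr
        linarith [Real.add_one_le_exp y]
    _ = Real.exp (-ξ ^ 2 / 2) := by
        rw [← Real.exp_nat_mul, ← Real.exp_add]
        congr 1
        have : (r + ξ) ^ 2 = m * (1 + y) ^ 2 := by rw [hξy, ← hsq]; ring
        rw [this, hξy, mul_pow, hsq]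
        simp only [s]
        field_simp
        ring

end ChiSquare

/-! ### Projections of Gaussian vectors -/

section Projection

variable {E : Type*} [NormedAddCommGroup E] [InnerProductSpace ℝ E] [FiniteDimensional ℝ E]
  [MeasurableSpace E] [BorelSpace E]

lemma stdGaussian_map_orthogonalProjectionOnto (V : Submodule ℝ E) :
    (stdGaussian E).map V.orthogonalProjectionOnto = stdGaussian V := by
  have : IsProbabilityMeasure ((stdGaussian E).map V.orthogonalProjectionOnto) :=
    Measure.isProbabilityMeasure_map (by fun_prop)
  refine Measure.ext_of_charFun ?_
  ext t
  rw [charFun_stdGaussian, charFun_apply, integral_map (by fun_prop) (by fun_prop)]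
  have h := charFun_stdGaussian (t : E)
  rw [charFun_apply] at h
  simp_rw [Submodule.inner_orthogonalProjectionOnto_eq_of_mem_right]
  exact h

lemma stdGaussian_norm_sq_tail_le (hE : 0 < Module.finrank ℝ E) {ξ : ℝ} (hξ : 0 ≤ ξ) :
    (stdGaussian E).real {x | (Real.sqrt (Module.finrank ℝ E) + ξ) ^ 2 ≤ ‖x‖ ^ 2} ≤
      Real.exp (-ξ ^ 2 / 2) := by
  rw [stdGaussian, map_measureReal_apply (by fun_prop)
    (measurableSet_le measurable_const (by fun_prop))]
  refine le_trans (le_of_eq ?_) (chiSquare_tail_le hE hξ)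
  congr 1
  ext x
  have : ‖∑ i, x i • stdOrthonormalBasis ℝ E i‖ ^ 2 = ∑ i, x i ^ 2 := by
    rw [← (stdOrthonormalBasis ℝ E).sum_sq_norm_inner_right]
    refine Finset.sum_congr rfl fun i _ => ?_
    rw [(stdOrthonormalBasis ℝ E).orthonormal.inner_right_fintype, Real.norm_eq_abs, sq_abs]
  simp only [Set.preimage_ofPred_eq, Set.mem_ofPred_eq, this]

end Projection

/-! ### Least squares residuals -/

section Residual

variable {n k : ℕ}

/-- The Gram matrix of the columns of `A`. -/
noncomputable def gram (A : Fin n → Fin k → ℝ) : Matrix (Fin k) (Fin k) ℝ :=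
  (Matrix.of A)ᵀ * Matrix.of A

/-- The coefficients of the least squares regression of `v` on the columns of `A`. -/
noncomputable def regressionCoeff (A : Fin n → Fin k → ℝ) (v : Fin n → ℝ) : Fin k → ℝ :=
  (gram A)⁻¹ *ᵥ ((Matrix.of A)ᵀ *ᵥ v)

/-- The residual of the least squares regression of `v` on the columns of `A`. -/
noncomputable def residual (A : Fin n → Fin k → ℝ) (v : Fin n → ℝ) : Fin n → ℝ :=
  v - Matrix.of A *ᵥ regressionCoeff A v

lemma continuous_gram : Continuous (gram : (Fin n → Fin k → ℝ) → Matrix (Fin k) (Fin k) ℝ) := by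
  unfold gram
  have : Continuous fun A : Fin n → Fin k → ℝ => Matrix.of A := continuous_id
  fun_prop

/-- The adjugate formula for the inverse makes the coefficients measurable everywhere, including at
singular Gram matrices. -/
lemma measurable_regressionCoeff :
    Measurable fun z : (Fin n → Fin k → ℝ) × (Fin n → ℝ) => regressionCoeff z.1 z.2 := by
  have h : (fun z : (Fin n → Fin k → ℝ) × (Fin n → ℝ) => regressionCoeff z.1 z.2) = fun z =>
      ((gram z.1).det)⁻¹ • ((gram z.1).adjugate *ᵥ ((Matrix.of z.1)ᵀ *ᵥ z.2)) := by
    ext z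
    rw [regressionCoeff, Matrix.inv_def, Ring.inverse_eq_inv', Matrix.smul_mulVec]
  rw [h]
  have hg : Continuous fun z : (Fin n → Fin k → ℝ) × (Fin n → ℝ) => gram z.1 :=
    continuous_gram.comp continuous_fst
  have ho : Continuous fun z : (Fin n → Fin k → ℝ) × (Fin n → ℝ) => Matrix.of z.1 :=
    continuous_fst
  refine Measurable.smul hg.matrix_det.measurable.inv ?_
  exact (hg.matrix_adjugate.matrix_mulVec (ho.matrix_transpose.matrix_mulVec
    continuous_snd)).measurable

lemma measurable_residual :
    Measurable fun z : (Fin n → Fin k → ℝ) × (Fin n → ℝ) => residual z.1 z.2 := by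
  have h : Measurable fun z : (Fin n → Fin k → ℝ) × (Fin n → ℝ) =>
      Matrix.of z.1 *ᵥ regressionCoeff z.1 z.2 := by
    refine measurable_pi_lambda _ fun a => ?_
    have h2 := measurable_regressionCoeff (n := n) (k := k)
    simp only [Matrix.mulVec, dotProduct, Matrix.of_apply]
    fun_prop
  exact measurable_snd.sub h

lemma transpose_mulVec_residual {A : Fin n → Fin k → ℝ} (hA : (gram A).det ≠ 0) (v : Fin n → ℝ) :
    (Matrix.of A)ᵀ *ᵥ residual A v = 0 := by
  rw [residual, Matrix.mulVec_sub, Matrix.mulVec_mulVec, regressionCoeff]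
  change _ - gram A *ᵥ _ = 0
  rw [Matrix.mulVec_mulVec, Matrix.mul_nonsing_inv _ (isUnit_iff_ne_zero.2 hA), Matrix.one_mulVec,
    sub_self]

lemma gram_det_ne_zero_iff (A : Fin n → Fin k → ℝ) :
    (gram A).det ≠ 0 ↔ ∀ x, Matrix.of A *ᵥ x = 0 → x = 0 := by
  have h := congrArg (fun S => ∀ x, x ∈ S → x = 0)
    (Matrix.ker_mulVecLin_transpose_mul_self (Matrix.of A))
  simp only [LinearMap.mem_ker, Matrix.mulVecLin_apply] at h
  rw [← h, Ne, ← Matrix.exists_mulVec_eq_zero_iff]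
  push Not
  exact ⟨fun H x hx => by_contra fun hx0 => H x hx0 hx, fun H x hx0 hx => hx0 (H x hx)⟩

/-- For independent columns the residual is the orthogonal projection onto the complement of the
column span, whose dimension is `n - k`. The projected vector is standard Gaussian there. -/
lemma residual_tail_le {A : Fin n → Fin k → ℝ} (hA : (gram A).det ≠ 0) (hk : k < n) {ξ : ℝ}
    (hξ : 0 ≤ ξ) :
    (stdPi (Fin n)).real
      {v | (Real.sqrt ((n : ℝ) - k) + ξ) ^ 2 ≤ residual A v ⬝ᵥ residual A v} ≤
        Real.exp (-ξ ^ 2 / 2) := by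
  let f : (Fin k → ℝ) →ₗ[ℝ] EuclideanSpace ℝ (Fin n) :=
    (WithLp.linearEquiv 2 ℝ (Fin n → ℝ)).symm.toLinearMap ∘ₗ (Matrix.of A).mulVecLin
  have hfx : ∀ x, f x = WithLp.toLp 2 (Matrix.of A *ᵥ x) := fun x => rfl
  have hinj : Function.Injective f := by
    rw [← LinearMap.ker_eq_bot, LinearMap.ker_eq_bot']
    intro x hx
    rw [hfx, WithLp.toLp_eq_zero] at hx
    exact (gram_det_ne_zero_iff A).1 hA x hx
  set V := LinearMap.range f
  have hV : Module.finrank ℝ V = k := by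
    rw [LinearMap.finrank_range_of_inj hinj, Module.finrank_fin_fun]
  have hVo : Module.finrank ℝ Vᗮ = n - k := by
    have := Submodule.finrank_add_finrank_orthogonal V
    rw [hV, finrank_euclideanSpace_fin] at this
    omega
  have hres : ∀ v : Fin n → ℝ,
      Vᗮ.starProjection (WithLp.toLp 2 v) = WithLp.toLp 2 (residual A v) := by
    intro v
    refine Submodule.eq_starProjection_of_mem_orthogonal ?_ ?_
    · rw [Submodule.mem_orthogonal]
      rintro _ ⟨x, rfl⟩
      rw [hfx, EuclideanSpace.inner_toLp_toLp, star_trivial, Matrix.dotProduct_mulVec,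
        ← Matrix.mulVec_transpose, transpose_mulVec_residual hA, zero_dotProduct]
    · rw [Submodule.orthogonal_orthogonal]
      refine ⟨regressionCoeff A v, ?_⟩
      rw [hfx, ← WithLp.toLp_sub, residual, sub_sub_cancel]
  have hnorm : ∀ v : Fin n → ℝ, residual A v ⬝ᵥ residual A v =
      ‖Vᗮ.orthogonalProjectionOnto (WithLp.toLp 2 v)‖ ^ 2 := by
    intro v
    have : ‖Vᗮ.orthogonalProjectionOnto (WithLp.toLp 2 v)‖ =
        ‖Vᗮ.starProjection (WithLp.toLp 2 v)‖ := rfl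
    rw [this, hres, EuclideanSpace.real_norm_sq_eq, dotProduct]
    simp [sq]
  have htail := stdGaussian_norm_sq_tail_le (E := Vᗮ) (by rw [hVo]; omega) hξ
  rw [hVo, Nat.cast_sub hk.le, ← stdGaussian_map_orthogonalProjectionOnto, ← map_pi_eq_stdGaussian,
    Measure.map_map (by fun_prop) (by fun_prop),
    map_measureReal_apply (by fun_prop) (measurableSet_le measurable_const (by fun_prop))] at htail
  refine le_trans (le_of_eq ?_) htail
  congr 1
  ext v
  simp only [Set.preimage_ofPred_eq, Set.mem_ofPred_eq, hnorm, Function.comp]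

end Residual

/-! ### Gaussian designs: splitting off a column, independence of columns -/

section Design

lemma stdPi_map_comp {κ ι : Type*} [Fintype κ] [Fintype ι] {g : κ → ι}
    (hg : Function.Injective g) :
    (stdPi ι).map (fun x l => x (g l)) = stdPi κ := by
  have h := (iIndepFun_pi (μ := fun _ : ι => gaussianReal 0 1) (X := fun _ x => x)
    (fun i => aemeasurable_id)).precomp hg
  rw [iIndepFun_iff_map_fun_eq_pi_map (fun i => (measurable_pi_apply _).aemeasurable)] at h
  rw [h]
  congr 1
  ext1 l
  exact (measurePreserving_eval (fun _ : ι => gaussianReal 0 1) (g l)).map_eq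

lemma stdPi_map_split {p k : ℕ} (e : Fin k → Fin p) (he : Function.Injective e) (i : Fin p)
    (hi : ∀ l, e l ≠ i) :
    (stdPi (Fin p)).map (fun x => ((fun l => x (e l)), x i)) =
      (stdPi (Fin k)).prod (gaussianReal 0 1) := by
  let g : Fin (k + 1) → Fin p := Fin.cons i e
  have hg : Function.Injective g := by
    rw [Fin.cons_injective_iff]
    exact ⟨fun ⟨l, hl⟩ => hi l hl, he⟩
  have h2 := (measurePreserving_piFinSuccAbove (fun _ : Fin (k + 1) => gaussianReal 0 1) 0).map_eq
  change (stdPi (Fin (k + 1))).map _ = _ at h2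
  rw [← stdPi_map_comp hg, Measure.map_map (MeasurableEquiv.measurable _) (by fun_prop)] at h2
  rw [← Measure.prod_swap, ← h2, Measure.map_map measurable_swap
    ((MeasurableEquiv.measurable _).comp (by fun_prop))]
  rfl

lemma designLaw_map_split {n p k : ℕ} (e : Fin k → Fin p) (he : Function.Injective e) (i : Fin p)
    (hi : ∀ l, e l ≠ i) :
    (designLaw n p).map (fun X => ((fun a l => X a (e l)), fun a => X a i)) =
      (designLaw n k).prod (stdPi (Fin n)) := by
  have h1 := stdPi_map_split e he i hi
  have h2 := Measure.pi_map_pi (ι := Fin n) (μ := fun _ => stdPi (Fin p))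
    (f := fun _ x => ((fun l => x (e l)), x i)) (hμ := fun _ => by rw [h1]; infer_instance)
    (fun _ => by fun_prop)
  simp_rw [h1] at h2
  have h3 := (measurePreserving_arrowProdEquivProdArrow (Fin k → ℝ) ℝ (Fin n)
    (fun _ => stdPi (Fin k)) (fun _ => gaussianReal 0 1)).map_eq
  rw [← h2, Measure.map_map (MeasurableEquiv.measurable _) (by fun_prop)] at h3
  exact h3

instance (n p : ℕ) : IsProbabilityMeasure (designLaw n p) := by
  unfold designLaw; infer_instance

lemma measurableSet_gram_det_ne_zero (n k : ℕ) :
    MeasurableSet {A : Fin n → Fin k → ℝ | (gram A).det ≠ 0} :=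
  (isOpen_ne_fun continuous_gram.matrix_det continuous_const).measurableSet

lemma exists_orthogonal_column {n k : ℕ} (hk : k < n) (A : Fin n → Fin k → ℝ) :
    ∃ a : Fin n → ℝ, a ≠ 0 ∧ ∀ x, a ⬝ᵥ (Matrix.of A *ᵥ x) = 0 := by
  have h : (Matrix.of A)ᵀ.mulVecLin.ker ≠ ⊥ :=
    LinearMap.ker_ne_bot_of_finrank_lt (by simpa using hk)
  obtain ⟨a, ha, ha0⟩ := Submodule.exists_mem_ne_zero_of_ne_bot h
  refine ⟨a, ha0, fun x => ?_⟩
  rw [LinearMap.mem_ker, Matrix.mulVecLin_apply] at ha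
  rw [Matrix.dotProduct_mulVec, ← Matrix.mulVec_transpose, ha, zero_dotProduct]

lemma ae_dotProduct_ne_zero {ι : Type*} [Fintype ι] {a : ι → ℝ} (ha : a ≠ 0) :
    ∀ᵐ v ∂(stdPi ι), a ⬝ᵥ v ≠ 0 := by
  have h : ∀ᵐ x ∂((stdPi ι).map fun v => a ⬝ᵥ v), x ≠ 0 := by
    have hm : MeasurableSet {x : ℝ | x ≠ 0} := (measurableSet_singleton 0).compl
    rw [stdPi_map_dotProduct, ae_map_iff (by fun_prop) hm]
    have hs : Real.sqrt (a ⬝ᵥ a) ≠ 0 := by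
      rw [Real.sqrt_ne_zero (dotProduct_self_nonneg_real a)]
      exact fun h => ha (dotProduct_self_eq_zero.1 h)
    have hne : ∀ᵐ z ∂(gaussianReal 0 1), z ≠ (0 : ℝ) := by
      rw [ae_iff]; simp
    filter_upwards [hne] with z hz using mul_ne_zero hs hz
  exact ae_of_ae_map (continuous_dotProduct_right a).aemeasurable h

/-- The columns of a standard Gaussian design are almost surely linearly independent. -/
lemma ae_gram_det_ne_zero {n k : ℕ} (hk : k ≤ n) : ∀ᵐ A ∂(designLaw n k), (gram A).det ≠ 0 := by
  induction k with
  | zero => exact .of_forall fun A => by simp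
  | succ k ih =>
    let join : (Fin n → Fin k → ℝ) × (Fin n → ℝ) → Fin n → Fin (k + 1) → ℝ :=
      fun z a => Fin.cons (z.2 a) (z.1 a)
    have hjoin : Measurable join := by
      refine measurable_pi_lambda _ fun a => measurable_pi_lambda _ fun j => ?_
      refine Fin.cases ?_ (fun l => ?_) j <;> simp only [join, Fin.cons_zero, Fin.cons_succ] <;>
        fun_prop
    have key : ∀ᵐ z ∂((designLaw n k).prod (stdPi (Fin n))), (gram (join z)).det ≠ 0 := by
      have hm : MeasurableSet {z | (gram (join z)).det ≠ 0} :=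
        hjoin (measurableSet_gram_det_ne_zero n (k + 1))
      rw [Measure.ae_prod_iff_ae_ae hm]
      filter_upwards [ih (by omega)] with A hA
      -- Pairing a linear relation between `v` and the columns of `A` with a vector `a` orthogonal
      -- to those columns leaves `x 0 * (a ⬝ᵥ v) = 0`, and almost surely `a ⬝ᵥ v ≠ 0`.
      obtain ⟨a, ha, hao⟩ := exists_orthogonal_column (by omega) A
      filter_upwards [ae_dotProduct_ne_zero ha] with v hv
      rw [gram_det_ne_zero_iff]
      intro x hx
      have e1 : Matrix.of (join (A, v)) *ᵥ x = x 0 • v + Matrix.of A *ᵥ (fun l => x l.succ) := by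
        ext b
        simp [join, Matrix.mulVec, dotProduct, Fin.sum_univ_succ, mul_comm]
      rw [e1] at hx
      have e2 := congrArg (fun w => a ⬝ᵥ w) hx
      simp only [dotProduct_add, dotProduct_smul, hao, add_zero, dotProduct_zero, smul_eq_mul,
        mul_eq_zero, hv, or_false] at e2
      rw [e2, zero_smul, zero_add] at hx
      have e3 := (gram_det_ne_zero_iff A).1 hA _ hx
      ext j
      refine Fin.cases e2 (fun l => congrFun e3 l) j
    rw [← designLaw_map_split Fin.succ (Fin.succ_injective k) 0 (fun l => Fin.succ_ne_zero l)]
      at key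
    filter_upwards [ae_of_ae_map (by fun_prop) key] with A hA
    convert hA using 3
    ext a j
    refine Fin.cases ?_ (fun l => ?_) j <;> simp [join]

/-- A standard Gaussian column has a small residual with respect to `k` other columns. -/
lemma designLaw_residual_tail_le {n p k : ℕ} (hk : k < n) (e : Fin k → Fin p)
    (he : Function.Injective e) (i : Fin p) (hi : ∀ l, e l ≠ i) {ξ : ℝ} (hξ : 0 ≤ ξ) :
    (designLaw n p).real {X | (Real.sqrt ((n : ℝ) - k) + ξ) ^ 2 ≤
      residual (fun a l => X a (e l)) (fun a => X a i) ⬝ᵥ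
        residual (fun a l => X a (e l)) (fun a => X a i)} ≤ Real.exp (-ξ ^ 2 / 2) := by
  set ρ := (Real.sqrt ((n : ℝ) - k) + ξ) ^ 2
  let S : Set ((Fin n → Fin k → ℝ) × (Fin n → ℝ)) :=
    {z | ρ ≤ residual z.1 z.2 ⬝ᵥ residual z.1 z.2}
  have hS : MeasurableSet S := by
    refine measurableSet_le measurable_const ?_
    have := measurable_residual (n := n) (k := k)
    simp only [dotProduct]
    fun_prop
  have h1 : (designLaw n p).real {X | ρ ≤ residual (fun a l => X a (e l)) (fun a => X a i) ⬝ᵥ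
      residual (fun a l => X a (e l)) (fun a => X a i)} =
      ((designLaw n k).prod (stdPi (Fin n))).real S := by
    rw [← designLaw_map_split e he i hi, map_measureReal_apply (by fun_prop) hS]
    rfl
  rw [h1, measureReal_def]
  refine ENNReal.toReal_le_of_le_ofReal (Real.exp_pos _).le ?_
  rw [Measure.prod_apply hS]
  calc ∫⁻ A, (stdPi (Fin n)) (Prod.mk A ⁻¹' S) ∂(designLaw n k)
      ≤ ∫⁻ _, ENNReal.ofReal (Real.exp (-ξ ^ 2 / 2)) ∂(designLaw n k) := by
        refine lintegral_mono_ae ?_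
        filter_upwards [ae_gram_det_ne_zero hk.le] with A hA
        rw [← ofReal_measureReal]
        exact ENNReal.ofReal_le_ofReal (residual_tail_le hA hk hξ)
    _ = _ := by simp

end Design

/-! ### Bounds for a fixed design under the Gaussian prior -/

lemma integrable_of_mem_unit {α : Type*} [MeasurableSpace α] {μ : Measure α} [IsFiniteMeasure μ]
    {f : α → ℝ} (hf : Measurable f) (h0 : ∀ x, 0 ≤ f x) (h1 : ∀ x, f x ≤ 1) : Integrable f μ := by
  refine Integrable.of_bound hf.aestronglyMeasurable 1 (.of_forall fun x => ?_)
  rw [Real.norm_eq_abs, abs_of_nonneg (h0 x)]; exact h1 x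

lemma integral_le_one_of_le_one {α : Type*} [MeasurableSpace α] {μ : Measure α}
    [IsProbabilityMeasure μ] {f : α → ℝ} (hf : Measurable f) (h0 : ∀ x, 0 ≤ f x)
    (h1 : ∀ x, f x ≤ 1) : ∫ x, f x ∂μ ≤ 1 := by
  have := integral_mono (integrable_of_mem_unit (μ := μ) hf h0 h1) (integrable_const 1) h1
  simpa using this

section FixedDesign

variable {n k : ℕ}

/-- The mean of the function `g` of the response for the design `A`, the parameter `t` and an
additional shift `m` of the mean. -/
noncomputable def designMean (g : (Fin n → ℝ) → ℝ) (σ : ℝ) (A : Fin n → Fin k → ℝ) (m : Fin n → ℝ)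
    (t : Fin k → ℝ) : ℝ :=
  ∫ w, g (Matrix.of A *ᵥ t + m + σ • w) ∂(stdPi (Fin n))

lemma measurable_designMean_integrand {g : (Fin n → ℝ) → ℝ} (hg : Measurable g) (σ τ : ℝ)
    (A : Fin n → Fin k → ℝ) (m : Fin n → ℝ) :
    Measurable fun q : (Fin k → ℝ) × (Fin n → ℝ) =>
      g (Matrix.of A *ᵥ (τ • q.1) + m + σ • q.2) := by
  refine hg.comp (measurable_pi_lambda _ fun a => ?_)
  simp only [Pi.add_apply, Pi.smul_apply, Matrix.mulVec, dotProduct, smul_eq_mul]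
  fun_prop

lemma measurable_designMean {g : (Fin n → ℝ) → ℝ} (hg : Measurable g) (σ τ : ℝ)
    (A : Fin n → Fin k → ℝ) (m : Fin n → ℝ) :
    Measurable fun t => designMean g σ A m (τ • t) :=
  (measurable_designMean_integrand hg σ τ A m).stronglyMeasurable.integral_prod_right'.measurable

lemma designMean_nonneg {g : (Fin n → ℝ) → ℝ} (h0 : ∀ y, 0 ≤ g y) (σ : ℝ)
    (A : Fin n → Fin k → ℝ) (m : Fin n → ℝ) (t : Fin k → ℝ) : 0 ≤ designMean g σ A m t :=
  integral_nonneg fun _ => h0 _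

lemma designMean_le_one {g : (Fin n → ℝ) → ℝ} (hg : Measurable g) (h0 : ∀ y, 0 ≤ g y)
    (h1 : ∀ y, g y ≤ 1) (σ : ℝ) (A : Fin n → Fin k → ℝ) (m : Fin n → ℝ) (t : Fin k → ℝ) :
    designMean g σ A m t ≤ 1 :=
  integral_le_one_of_le_one (hg.comp (by fun_prop)) (fun _ => h0 _) (fun _ => h1 _)

/-- Averaging the parameter over a Gaussian prior with standard deviation `τ` replaces the shift
along a vector by the shift along its regression residual, up to a small error. -/
lemma integral_designMean_le {g : (Fin n → ℝ) → ℝ} (hg : Measurable g) (h0 : ∀ y, 0 ≤ g y)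
    (h1 : ∀ y, g y ≤ 1) {τ : ℝ} (hτ : 0 < τ) (σ b : ℝ) (A : Fin n → Fin k → ℝ) (v : Fin n → ℝ) :
    ∫ t, designMean g σ A (b • v) (τ • t) ∂(stdPi (Fin k)) ≤
      ∫ t, designMean g σ A (b • residual A v) (τ • t) ∂(stdPi (Fin k)) +
      Real.sqrt (Real.exp (b ^ 2 / τ ^ 2 * (regressionCoeff A v ⬝ᵥ regressionCoeff A v)) - 1) := by
  have key := integral_comp_add_stdPi_le ((b / τ) • regressionCoeff A v)
    (measurable_designMean hg σ τ A (b • residual A v)) (fun t => designMean_nonneg h0 _ _ _ _)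
    (fun t => designMean_le_one hg h0 h1 _ _ _ _)
  have e1 : ((b / τ) • regressionCoeff A v) ⬝ᵥ ((b / τ) • regressionCoeff A v) =
      b ^ 2 / τ ^ 2 * (regressionCoeff A v ⬝ᵥ regressionCoeff A v) := by
    rw [smul_dotProduct, dotProduct_smul, smul_eq_mul, smul_eq_mul]; ring
  -- The component of `b • v` in the column span is traded for a translation of the prior variable
  -- by `b / τ` times the coefficients.
  have e2 : ∀ t, designMean g σ A (b • v) (τ • t) =
      designMean g σ A (b • residual A v) (τ • (t + (b / τ) • regressionCoeff A v)) := by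
    intro t
    have : Matrix.of A *ᵥ (τ • (t + (b / τ) • regressionCoeff A v)) + b • residual A v =
        Matrix.of A *ᵥ (τ • t) + b • v := by
      rw [smul_add, smul_smul, mul_div_cancel₀ _ hτ.ne', Matrix.mulVec_add,
        Matrix.mulVec_smul _ b, add_assoc, ← smul_add, residual, add_sub_cancel]
    simp only [designMean, this]
  rw [e1] at key
  simp_rw [e2]
  exact key

lemma average_designMean_residual_le {g : (Fin n → ℝ) → ℝ} (hg : Measurable g) (h0 : ∀ y, 0 ≤ g y)
    (h1 : ∀ y, g y ≤ 1) {σ : ℝ} (hσ : 0 < σ) {c u₀ μ : ℝ} (hc : 0 ≤ c) (hu₀ : 0 ≤ u₀)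
    (A : Fin n → Fin k → ℝ) (r : Fin n → ℝ) (hr : μ ^ 2 * (r ⬝ᵥ r) ≤ (u₀ * σ) ^ 2)
    (t : Fin k → ℝ) :
    (designMean g σ A (μ • r) t + designMean g σ A (-μ • r) t) / 2 ≤
      mixtureRatio u₀ c * designMean g σ A 0 t +
      (twoSidedPower c u₀ - mixtureRatio u₀ c * twoSidedPower c 0) := by
  have ha : ((μ / σ) • r) ⬝ᵥ ((μ / σ) • r) ≤ u₀ ^ 2 := by
    rw [smul_dotProduct, dotProduct_smul, smul_eq_mul, smul_eq_mul]
    have : μ / σ * (μ / σ * (r ⬝ᵥ r)) = μ ^ 2 * (r ⬝ᵥ r) / σ ^ 2 := by field_simp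
    rw [this, div_le_iff₀ (by positivity), ← mul_pow]
    exact hr
  have hf : Measurable fun w => g (Matrix.of A *ᵥ t + 0 + σ • w) := hg.comp (by fun_prop)
  have hav := average_shift_le hc hu₀ ((μ / σ) • r) ha hf (fun _ => h0 _) (fun _ => h1 _)
  have es : ∀ (w : Fin n → ℝ) (b : ℝ), Matrix.of A *ᵥ t + 0 + σ • (w + (b / σ) • r) =
      Matrix.of A *ᵥ t + b • r + σ • w := by
    intro w b
    rw [smul_add, smul_smul, mul_div_cancel₀ _ hσ.ne', add_zero, add_assoc _ (b • r),
      add_comm (b • r)]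
  simp only [← neg_smul, ← neg_div, es] at hav
  exact hav

lemma average_designMean_le {g : (Fin n → ℝ) → ℝ} (hg : Measurable g) (h0 : ∀ y, 0 ≤ g y)
    (h1 : ∀ y, g y ≤ 1) {τ σ : ℝ} (hτ : 0 < τ) (hσ : 0 < σ) {c u₀ μ : ℝ} (hc : 0 ≤ c)
    (hu₀ : 0 ≤ u₀) (A : Fin n → Fin k → ℝ) (v : Fin n → ℝ)
    (hr : μ ^ 2 * (residual A v ⬝ᵥ residual A v) ≤ (u₀ * σ) ^ 2) :
    (∫ t, designMean g σ A (μ • v) (τ • t) ∂(stdPi (Fin k)) +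
      ∫ t, designMean g σ A (-μ • v) (τ • t) ∂(stdPi (Fin k))) / 2 ≤
      mixtureRatio u₀ c * ∫ t, designMean g σ A 0 (τ • t) ∂(stdPi (Fin k)) +
      (twoSidedPower c u₀ - mixtureRatio u₀ c * twoSidedPower c 0) +
      Real.sqrt (Real.exp (μ ^ 2 / τ ^ 2 * (regressionCoeff A v ⬝ᵥ regressionCoeff A v)) - 1) := by
  have k1 := integral_designMean_le hg h0 h1 hτ σ μ A v
  have k2 := integral_designMean_le hg h0 h1 hτ σ (-μ) A v
  rw [neg_sq] at k2
  have hi : ∀ m, Integrable (fun t => designMean g σ A m (τ • t)) (stdPi (Fin k)) := fun m =>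
    integrable_of_mem_unit (measurable_designMean hg σ τ A m)
      (fun t => designMean_nonneg h0 _ _ _ _) (fun t => designMean_le_one hg h0 h1 _ _ _ _)
  have hint := integral_mono
    (((hi (μ • residual A v)).add (hi (-μ • residual A v))).div_const 2)
    (((hi 0).const_mul (mixtureRatio u₀ c)).add
      (integrable_const (twoSidedPower c u₀ - mixtureRatio u₀ c * twoSidedPower c 0)))
    (fun t => average_designMean_residual_le hg h0 h1 hσ hc hu₀ A (residual A v) hr (τ • t))
  simp only [Pi.add_apply] at hint
  rw [integral_div, integral_add (hi _) (hi _), integral_add ((hi 0).const_mul _)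
    (integrable_const _), integral_const_mul, integral_const, probReal_univ, one_smul] at hint
  linarith

end FixedDesign

/-- No moment of `D` is needed: truncation at 1, harmless because powers are at most 1, provides the
dominating function. -/
lemma tendsto_integral_priorError {Ω : Type*} [MeasurableSpace Ω] (P : Measure Ω)
    [IsProbabilityMeasure P] (s : ℝ) {D : Ω → ℝ} (hD : Measurable D) :
    Filter.Tendsto (fun N : ℕ => ∫ x, min 1 (√(Real.exp (s / ((N : ℝ) + 1) ^ 2 * D x) - 1)) ∂P)
      Filter.atTop (nhds 0) := by
  have h := tendsto_integral_of_dominated_convergence (μ := P)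
    (F := fun (N : ℕ) x => min 1 (√(Real.exp (s / ((N : ℝ) + 1) ^ 2 * D x) - 1)))
    (f := fun _ => (0 : ℝ)) (fun _ => (1 : ℝ)) (fun N => by fun_prop) (integrable_const 1)
    (fun N => .of_forall fun x => by
      rw [Real.norm_eq_abs, abs_of_nonneg (le_min zero_le_one (Real.sqrt_nonneg _))]
      exact min_le_left _ _)
    (.of_forall fun x => ?_)
  · simpa using h
  · have t1 : Filter.Tendsto (fun N : ℕ => ((N : ℝ) + 1) ^ 2) Filter.atTop Filter.atTop :=
      (Filter.tendsto_pow_atTop two_ne_zero).comp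
        (Filter.tendsto_atTop_add_const_right _ 1 tendsto_natCast_atTop_atTop)
    have t2 : Filter.Tendsto (fun N : ℕ => s / ((N : ℝ) + 1) ^ 2) Filter.atTop (nhds 0) :=
      t1.const_div_atTop _
    have hcont : Continuous fun y : ℝ => min 1 (√(Real.exp (y * D x) - 1)) := by fun_prop
    have := (hcont.tendsto 0).comp t2
    simpa [Function.comp_def] using this

/-- Integration of a bound that holds off a bad event and up to an error term. -/
lemma integral_average_le {Ω : Type*} [MeasurableSpace Ω] {P : Measure Ω} [IsProbabilityMeasure P]
    {f₁ f₂ f₀ η : Ω → ℝ} {bad : Set Ω} (hf₁ : Integrable f₁ P) (hf₂ : Integrable f₂ P)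
    (hf₀ : Integrable f₀ P) (hη : Measurable η) (hbad : MeasurableSet bad)
    (h₁ : ∀ x, f₁ x ≤ 1) (h₂ : ∀ x, f₂ x ≤ 1) (h₀ : ∀ x, 0 ≤ f₀ x) (hη0 : ∀ x, 0 ≤ η x)
    {l C : ℝ} (hl : 0 ≤ l) (hC : 0 ≤ C)
    (h : ∀ x ∉ bad, (f₁ x + f₂ x) / 2 ≤ l * f₀ x + C + η x) :
    (∫ x, f₁ x ∂P + ∫ x, f₂ x ∂P) / 2 ≤
      l * ∫ x, f₀ x ∂P + C + P.real bad + ∫ x, min 1 (η x) ∂P := by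
  have i1 : Integrable (fun x => l * f₀ x) P := hf₀.const_mul l
  have i2 : Integrable (fun x => l * f₀ x + C) P := i1.add (integrable_const C)
  have i3 : Integrable (bad.indicator (fun _ => (1 : ℝ))) P := (integrable_const 1).indicator hbad
  have i4 : Integrable (fun x => l * f₀ x + C + bad.indicator (fun _ => (1 : ℝ)) x) P := i2.add i3
  have i5 : Integrable (fun x => min 1 (η x)) P :=
    integrable_of_mem_unit (measurable_const.min hη) (fun x => le_min zero_le_one (hη0 x))
      (fun x => min_le_left _ _)
  have hI : ∫ x, (f₁ x + f₂ x) / 2 ∂P ≤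
      ∫ x, (l * f₀ x + C + bad.indicator (fun _ => (1 : ℝ)) x + min 1 (η x)) ∂P := by
    refine integral_mono ((hf₁.add hf₂).div_const 2) (i4.add i5) fun x => ?_
    have hY : 0 ≤ l * f₀ x + C := by have := h₀ x; positivity
    have hle1 : (f₁ x + f₂ x) / 2 ≤ 1 := by linarith [h₁ x, h₂ x]
    -- On the bad event, or where `η` exceeds 1, the trivial bound 1 on the average is enough.
    by_cases hx : x ∈ bad
    · have : 0 ≤ min 1 (η x) := le_min zero_le_one (hη0 x)
      simp only [Set.indicator_of_mem hx]
      linarith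
    · have := h x hx
      simp only [Set.indicator_of_notMem hx]
      rcases min_cases (1 : ℝ) (η x) with h | h <;> rw [h.1] <;> linarith
  rw [integral_div, integral_add hf₁ hf₂, integral_add i4 i5, integral_add i2 i3,
    integral_add i1 (integrable_const C), integral_const_mul, integral_indicator_const _ hbad] at hI
  simpa using hI

/-! ### Averaging over the design and letting the prior widen -/

section Core

variable {n p k : ℕ}

/-- The conditional mean, given the design, of a function `φ` of the data when the parameter has
the value `b` at `i`, the values `t` at the positions `e`, and vanishes elsewhere. -/
noncomputable def condMean (φ : (Fin n → ℝ) × (Fin n → Fin p → ℝ) → ℝ) (σ : ℝ) (e : Fin k → Fin p)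
    (i : Fin p) (b : ℝ) (X : Fin n → Fin p → ℝ) (t : Fin k → ℝ) : ℝ :=
  designMean (fun y => φ (y, X)) σ (fun a l => X a (e l)) (b • fun a => X a i) t

variable {φ : (Fin n → ℝ) × (Fin n → Fin p → ℝ) → ℝ} (hφ : Measurable φ)
  (h0 : ∀ z, 0 ≤ φ z) (h1 : ∀ z, φ z ≤ 1) {σ : ℝ} {e : Fin k → Fin p} {i : Fin p}

lemma condMean_nonneg (h0 : ∀ z, 0 ≤ φ z) (b : ℝ) (X : Fin n → Fin p → ℝ) (t : Fin k → ℝ) :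
    0 ≤ condMean φ σ e i b X t :=
  designMean_nonneg (fun _ => h0 _) _ _ _ _

include hφ in
lemma measurable_condMean (b : ℝ) :
    Measurable fun z : (Fin n → Fin p → ℝ) × (Fin k → ℝ) => condMean φ σ e i b z.1 z.2 := by
  have h : Measurable fun q : ((Fin n → Fin p → ℝ) × (Fin k → ℝ)) × (Fin n → ℝ) =>
      φ (Matrix.of (fun a l => q.1.1 a (e l)) *ᵥ q.1.2 + b • (fun a => q.1.1 a i) + σ • q.2,
        q.1.1) := by
    refine hφ.comp (Measurable.prodMk ?_ (by fun_prop))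
    refine measurable_pi_lambda _ fun a => ?_
    simp only [Pi.add_apply, Pi.smul_apply, Matrix.mulVec, dotProduct, Matrix.of_apply, smul_eq_mul]
    fun_prop
  exact h.stronglyMeasurable.integral_prod_right'.measurable

include hφ h0 h1 in
lemma condMean_le_one (b : ℝ) (X : Fin n → Fin p → ℝ) (t : Fin k → ℝ) :
    condMean φ σ e i b X t ≤ 1 :=
  designMean_le_one (hφ.comp (by fun_prop)) (fun _ => h0 _) (fun _ => h1 _) _ _ _ _

/-- The conditional mean of `φ` given the design under a Gaussian prior with standard deviation `τ`
on the values at the positions `e`. -/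
noncomputable def priorMean (φ : (Fin n → ℝ) × (Fin n → Fin p → ℝ) → ℝ) (σ : ℝ) (e : Fin k → Fin p)
    (i : Fin p) (τ b : ℝ) (X : Fin n → Fin p → ℝ) : ℝ :=
  ∫ t, condMean φ σ e i b X (τ • t) ∂(stdPi (Fin k))

include hφ in
lemma measurable_condMean_smul (τ b : ℝ) :
    Measurable fun z : (Fin n → Fin p → ℝ) × (Fin k → ℝ) => condMean φ σ e i b z.1 (τ • z.2) :=
  (measurable_condMean hφ b).comp (f := fun z : (Fin n → Fin p → ℝ) × (Fin k → ℝ) =>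
    (z.1, τ • z.2)) (by fun_prop)

lemma priorMean_nonneg (h0 : ∀ z, 0 ≤ φ z) (τ b : ℝ) (X : Fin n → Fin p → ℝ) :
    0 ≤ priorMean φ σ e i τ b X :=
  integral_nonneg fun _ => condMean_nonneg h0 _ _ _

include hφ h0 h1 in
lemma priorMean_le_one (τ b : ℝ) (X : Fin n → Fin p → ℝ) : priorMean φ σ e i τ b X ≤ 1 :=
  integral_le_one_of_le_one (f := fun t => condMean φ σ e i b X (τ • t))
    (Measurable.of_uncurry_left (f := fun X t => condMean φ σ e i b X (τ • t))
      (measurable_condMean_smul hφ τ b))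
    (fun t => condMean_nonneg h0 b X (τ • t)) (fun t => condMean_le_one hφ h0 h1 b X (τ • t))

include hφ h0 h1 in
lemma integrable_priorMean (τ b : ℝ) : Integrable (priorMean φ σ e i τ b) (designLaw n p) := by
  have h := (measurable_condMean_smul hφ (σ := σ) (e := e) (i := i) τ
    b).stronglyMeasurable.integral_prod_right' (ν := stdPi (Fin k))
  have hm : Measurable (priorMean φ σ e i τ b) := h.measurable
  exact integrable_of_mem_unit hm (priorMean_nonneg h0 τ b) (priorMean_le_one hφ h0 h1 τ b)

include hφ h0 h1 in
lemma integral_priorMean (τ b : ℝ) : ∫ X, priorMean φ σ e i τ b X ∂(designLaw n p) =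
    ∫ t, ∫ X, condMean φ σ e i b X (τ • t) ∂(designLaw n p) ∂(stdPi (Fin k)) := by
  refine integral_integral_swap ?_
  exact integrable_of_mem_unit (measurable_condMean_smul hφ τ b)
    (fun _ => condMean_nonneg h0 _ _ _) (fun _ => condMean_le_one hφ h0 h1 _ _ _)

include hφ h0 h1 in
lemma integrable_integral_condMean (τ b : ℝ) : Integrable
    (fun t => ∫ X, condMean φ σ e i b X (τ • t) ∂(designLaw n p)) (stdPi (Fin k)) := by
  have hm := measurable_condMean_smul hφ (σ := σ) (e := e) (i := i) τ b
  have h := hm.stronglyMeasurable.integral_prod_left' (μ := designLaw n p)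
  exact integrable_of_mem_unit h.measurable
    (fun t => integral_nonneg fun X => condMean_nonneg h0 b X (τ • t))
    (fun t => integral_le_one_of_le_one (f := fun X => condMean φ σ e i b X (τ • t))
      (Measurable.of_uncurry_right (f := fun X t => condMean φ σ e i b X (τ • t)) hm) (fun X => condMean_nonneg h0 b X (τ • t))
      (fun X => condMean_le_one hφ h0 h1 b X (τ • t)))

include hφ h0 h1 in
lemma le_integral_priorMean (τ b : ℝ) {a : ℝ}
    (h : ∀ t, a ≤ ∫ X, condMean φ σ e i b X t ∂(designLaw n p)) :
    a ≤ ∫ X, priorMean φ σ e i τ b X ∂(designLaw n p) := by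
  rw [integral_priorMean hφ h0 h1]
  have := integral_mono (integrable_const a) (integrable_integral_condMean hφ h0 h1 τ b)
    (fun t => h _)
  simpa using this

include hφ h0 h1 in
lemma integral_priorMean_le (τ b : ℝ) {a : ℝ}
    (h : ∀ t, ∫ X, condMean φ σ e i b X t ∂(designLaw n p) ≤ a) :
    ∫ X, priorMean φ σ e i τ b X ∂(designLaw n p) ≤ a := by
  rw [integral_priorMean hφ h0 h1]
  have := integral_mono (integrable_integral_condMean hφ h0 h1 τ b) (integrable_const a)
    (fun t => h _)
  simpa using this

lemma measurable_dotProduct_self {Ω κ : Type*} [MeasurableSpace Ω] [Fintype κ] {f : Ω → κ → ℝ}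
    (hf : Measurable f) : Measurable fun x => f x ⬝ᵥ f x := by
  simp only [dotProduct]
  fun_prop

lemma measurable_split (e : Fin k → Fin p) (i : Fin p) :
    Measurable fun X : Fin n → Fin p → ℝ => ((fun a l => X a (e l)), fun a => X a i) := by
  fun_prop

/-- The test that never rejects has Lagrangian value 0, which the optimum dominates. -/
lemma neymanPearson_const_nonneg {c u₀ : ℝ} (hc : 0 ≤ c) (hu₀ : 0 ≤ u₀) :
    0 ≤ twoSidedPower c u₀ - mixtureRatio u₀ c * twoSidedPower c 0 := by
  have := average_shift_le hc hu₀ (0 : Fin 0 → ℝ) (by simp; positivity) (f := fun _ => 0)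
    measurable_const (fun _ => le_rfl) (fun _ => zero_le_one)
  simp only [integral_zero, add_zero, zero_div, mul_zero, zero_add] at this
  exact this

lemma mixtureRatio_pos (u z : ℝ) : 0 < mixtureRatio u z :=
  mul_pos (Real.exp_pos _) (Real.cosh_pos _)

include hφ h0 h1 in
/-- If a randomized test has level `α` at all parameters supported on the positions `e`, then its
worst-case power at the parameters with the additional entry `±μ` at `i` is bounded by that of a
two-sided test with known nuisance parameters. -/
lemma power_le (hσ : 0 < σ) (hk : k < n) (he : Function.Injective e) (hi : ∀ l, e l ≠ i)
    {c ξ μ α π : ℝ} (hc : 0 ≤ c) (hξ : 0 ≤ ξ) (hμ : 0 ≤ μ)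
    (hlevel : ∀ t, ∫ X, condMean φ σ e i 0 X t ∂(designLaw n p) ≤ α)
    (hpos : ∀ t, π ≤ ∫ X, condMean φ σ e i μ X t ∂(designLaw n p))
    (hneg : ∀ t, π ≤ ∫ X, condMean φ σ e i (-μ) X t ∂(designLaw n p)) :
    π ≤ mixtureRatio (μ * (√((n : ℝ) - k) + ξ) / σ) c * α +
      (twoSidedPower c (μ * (√((n : ℝ) - k) + ξ) / σ) -
        mixtureRatio (μ * (√((n : ℝ) - k) + ξ) / σ) c * twoSidedPower c 0) +
      Real.exp (-ξ ^ 2 / 2) := by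
  have hbadP := designLaw_residual_tail_le hk e he i hi hξ
  set ρ := √((n : ℝ) - k) + ξ
  have hρ : 0 ≤ ρ := by positivity
  set u₀ := μ * ρ / σ with hu₀_def
  have hu₀ : 0 ≤ u₀ := by positivity
  have huρ : u₀ * σ = μ * ρ := by rw [hu₀_def]; field_simp
  have hR := measurable_dotProduct_self
    ((measurable_residual (n := n) (k := k)).comp (measurable_split (n := n) e i))
  have hD := measurable_dotProduct_self
    ((measurable_regressionCoeff (n := n) (k := k)).comp (measurable_split (n := n) e i))
  simp only [Function.comp_apply] at hR hD
  have hbad := measurableSet_le (measurable_const (a := ρ ^ 2)) hR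
  -- The prior standard deviation is `N + 1`. Only the last error term depends on it, and it
  -- vanishes as `N → ∞`.
  have hbound := fun N : ℕ => integral_average_le
    (integrable_priorMean hφ h0 h1 ((N : ℝ) + 1) μ)
    (integrable_priorMean hφ h0 h1 ((N : ℝ) + 1) (-μ))
    (integrable_priorMean hφ h0 h1 (i := i) ((N : ℝ) + 1) 0)
    (((hD.const_mul (μ ^ 2 / ((N : ℝ) + 1) ^ 2)).exp.sub_const 1).sqrt) hbad
    (priorMean_le_one hφ h0 h1 _ _) (priorMean_le_one hφ h0 h1 _ _) (priorMean_nonneg h0 _ _)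
    (fun _ => Real.sqrt_nonneg _) (mixtureRatio_pos u₀ c).le (neymanPearson_const_nonneg hc hu₀)
    (fun X hX => by
      have hX2 : μ ^ 2 * (residual (fun a l => X a (e l)) (fun a => X a i) ⬝ᵥ
          residual (fun a l => X a (e l)) (fun a => X a i)) ≤ (u₀ * σ) ^ 2 := by
        rw [huρ, mul_pow]
        exact mul_le_mul_of_nonneg_left (not_le.1 hX).le (sq_nonneg _)
      have hav := average_designMean_le (g := fun y => φ (y, X)) (hφ.comp (by fun_prop))
        (fun _ => h0 _) (fun _ => h1 _) (τ := (N : ℝ) + 1) (by positivity) hσ hc hu₀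
        (fun a l => X a (e l)) (fun a => X a i) hX2
      simp only [priorMean, condMean, zero_smul]
      exact hav)
  have hlim := (tendsto_integral_priorError (designLaw n p) (μ ^ 2) hD).const_add
    (mixtureRatio u₀ c * α + (twoSidedPower c u₀ - mixtureRatio u₀ c * twoSidedPower c 0) +
      Real.exp (-ξ ^ 2 / 2))
  rw [add_zero] at hlim
  refine ge_of_tendsto' hlim fun N => ?_
  have h2 := mul_le_mul_of_nonneg_left (integral_priorMean_le hφ h0 h1 ((N : ℝ) + 1) 0 hlevel)
    (mixtureRatio_pos u₀ c).le
  have h3 := le_integral_priorMean hφ h0 h1 ((N : ℝ) + 1) μ hpos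
  have h4 := le_integral_priorMean hφ h0 h1 ((N : ℝ) + 1) (-μ) hneg
  have h5 := hbound N
  linarith

end Core

/-! ### The normal distribution function, its quantiles and `G` -/

section Quantile

lemma stdCDF_sub_le {x y : ℝ} (h : x ≤ y) : stdCDF y - stdCDF x ≤ y - x := by
  have e : stdCDF y - stdCDF x = (gaussianReal 0 1).real (Set.Ioc x y) := by
    simpa using stdCDF_add_sub 0 x y h
  rw [e, measureReal_def]
  refine ENNReal.toReal_le_of_le_ofReal (sub_nonneg.2 h) ?_
  rw [gaussianReal_apply 0 one_ne_zero]
  calc ∫⁻ z in Set.Ioc x y, gaussianPDF 0 1 z ≤ ∫⁻ _ in Set.Ioc x y, 1 := by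
        refine lintegral_mono fun z => ?_
        rw [gaussianPDF]
        refine ENNReal.ofReal_le_one.2 ?_
        rw [gaussianPDFReal]
        have h1 : (√(2 * Real.pi * (1 : NNReal)))⁻¹ ≤ 1 := by
          refine inv_le_one_of_one_le₀ (Real.one_le_sqrt.2 ?_)
          have := Real.pi_gt_three
          simp only [NNReal.coe_one]
          linarith
        have h2 : Real.exp (-(z - 0) ^ 2 / (2 * (1 : NNReal))) ≤ 1 := by
          refine Real.exp_le_one_iff.2 ?_
          simp only [NNReal.coe_one]
          nlinarith [sq_nonneg (z - 0)]
        exact mul_le_one₀ h1 (Real.exp_pos _).le h2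
    _ = ENNReal.ofReal (y - x) := by simp

lemma stdCDF_strictMono : StrictMono stdCDF := by
  intro x y h
  have e : stdCDF y - stdCDF x = (gaussianReal 0 1).real (Set.Ioc x y) := by
    simpa using stdCDF_add_sub 0 x y h.le
  have hpos : 0 < (gaussianReal 0 1).real (Set.Ioc x y) := by
    rw [measureReal_def, ENNReal.toReal_pos_iff]
    refine ⟨pos_iff_ne_zero.2 fun h0 => ?_, measure_lt_top _ _⟩
    have := gaussianReal_absolutelyContinuous' 0 one_ne_zero h0
    rw [Real.volume_Ioc, ENNReal.ofReal_eq_zero] at this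
    linarith
  linarith

lemma continuous_stdCDF : Continuous stdCDF := by
  refine (LipschitzWith.of_le_add fun x y => ?_ : LipschitzWith 1 stdCDF).continuous
  rcases le_total x y with h | h
  · exact (stdCDF_strictMono.monotone h).trans (le_add_of_nonneg_right dist_nonneg)
  · rw [Real.dist_eq, abs_of_nonneg (sub_nonneg.2 h)]
    linarith [stdCDF_sub_le h]

lemma tendsto_stdCDF_atTop : Filter.Tendsto stdCDF Filter.atTop (nhds 1) := by
  have h : stdCDF = fun x => cdf (gaussianReal 0 1) x := by
    ext x; rw [cdf_eq_real, stdCDF]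
  rw [h]
  exact tendsto_cdf_atTop _

lemma stdCDF_lt_one (x : ℝ) : stdCDF x < 1 :=
  (stdCDF_strictMono (lt_add_one x)).trans_le measureReal_le_one

lemma stdCDF_zero : stdCDF 0 = 1 / 2 := by
  have := stdCDF_neg 0
  rw [neg_zero] at this
  linarith

lemma tendsto_twoSidedPower_atTop (u : ℝ) :
    Filter.Tendsto (fun c => twoSidedPower c u) Filter.atTop (nhds 0) := by
  have h1 := tendsto_stdCDF_atTop.comp (Filter.tendsto_atTop_add_const_right Filter.atTop u
    Filter.tendsto_id)
  have h2 := tendsto_stdCDF_atTop.comp (Filter.tendsto_atTop_add_const_right Filter.atTop (-u)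
    Filter.tendsto_id)
  have h3 := ((tendsto_const_nhds (x := (2 : ℝ))).sub h1).sub h2
  norm_num at h3
  refine h3.congr' ?_
  filter_upwards [Filter.eventually_ge_atTop 0] with c hc
  rw [twoSidedPower_eq hc]
  rfl

/-- The normal density is at most 1, so `stdCDF` is 1-Lipschitz; the term at `c + u` only helps. -/
lemma twoSidedPower_le_add {c u : ℝ} (hc : 0 ≤ c) (hu : 0 ≤ u) :
    twoSidedPower c u ≤ twoSidedPower c 0 + u := by
  rw [twoSidedPower_eq hc, twoSidedPower_zero hc]
  have h1 := stdCDF_sub_le (sub_le_self c hu)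
  have h2 := stdCDF_strictMono.monotone (le_add_of_nonneg_right hu : c ≤ c + u)
  linarith

lemma exists_twoSidedPower_eq {α : ℝ} (h0 : 0 < α) (h1 : α ≤ 1) :
    ∃ c : ℝ, 0 ≤ c ∧ stdCDF c = 1 - α / 2 := by
  obtain ⟨b, hb0, hb⟩ : ∃ b : ℝ, 0 ≤ b ∧ 1 - α / 2 < stdCDF b :=
    ((Filter.eventually_ge_atTop 0).and
      (tendsto_stdCDF_atTop.eventually_const_lt (by linarith))).exists
  obtain ⟨c, hc, hce⟩ := intermediate_value_Icc hb0 continuous_stdCDF.continuousOn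
    (show 1 - α / 2 ∈ Set.Icc _ _ from ⟨by rw [stdCDF_zero]; linarith, hb.le⟩)
  exact ⟨c, hc.1, hce⟩

lemma Phi_coe (x : ℝ) : Phi x = stdCDF x := by
  simp only [Phi, stdCDF, EReal.coe_le_coe_iff]
  rfl

lemma Phi_top : Phi ⊤ = 1 := by simp [Phi]

lemma Phi_bot : Phi ⊥ = 0 := by simp [Phi]

lemma PhiInv_stdCDF (c : ℝ) : PhiInv (stdCDF c) = c := by
  have hpos : 0 < stdCDF c :=
    lt_of_le_of_lt measureReal_nonneg (stdCDF_strictMono (sub_one_lt c))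
  refine IsLeast.csInf_eq ⟨by simp [Phi_coe], fun x hx => ?_⟩
  change stdCDF c ≤ Phi x at hx
  induction x with
  | bot => rw [Phi_bot] at hx; linarith
  | coe x => rw [Phi_coe] at hx; exact EReal.coe_le_coe_iff.2 (stdCDF_strictMono.le_iff_le.1 hx)
  | top => exact le_top

lemma PhiInv_one : PhiInv 1 = ⊤ := by
  refine IsLeast.csInf_eq ⟨by simp [Phi_top], fun x hx => ?_⟩
  change 1 ≤ Phi x at hx
  induction x with
  | bot => rw [Phi_bot] at hx; linarith
  | coe x => rw [Phi_coe] at hx; exact absurd hx (not_le.2 (stdCDF_lt_one x))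
  | top => exact le_rfl

lemma G_zero (u : ℝ) : G 0 u = 0 := by
  rw [G, zero_div, sub_zero, PhiInv_one, EReal.top_add_coe, EReal.top_sub_coe, Phi_top]
  norm_num

lemma G_eq_twoSidedPower {α c : ℝ} (hc : 0 ≤ c) (h : stdCDF c = 1 - α / 2) (u : ℝ) :
    G α u = twoSidedPower c u := by
  rw [G, ← h, PhiInv_stdCDF, ← EReal.coe_add, ← EReal.coe_sub, Phi_coe, Phi_coe,
    twoSidedPower_eq hc]

lemma G_nonneg {α : ℝ} (h0 : 0 ≤ α) (h1 : α ≤ 1) (u : ℝ) : 0 ≤ G α u := by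
  rcases h0.eq_or_lt with rfl | h0
  · rw [G_zero]
  · obtain ⟨c, hc, hce⟩ := exists_twoSidedPower_eq h0 h1
    rw [G_eq_twoSidedPower hc hce]
    exact twoSidedPower_nonneg c u

end Quantile

/-! ### From randomized tests to the power bound -/

section Tests

variable {n p k : ℕ}

lemma noiseLaw_eq_map (n : ℕ) (σ : ℝ) :
    noiseLaw n σ = (stdPi (Fin n)).map fun w => σ • w := by
  have h : (gaussianReal 0 1).map (fun x => σ * x) = gaussianReal 0 (Real.toNNReal (σ ^ 2)) := by
    rw [gaussianReal_map_const_mul, mul_zero, mul_one]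
    congr 1
    ext
    rw [Real.coe_toNNReal _ (sq_nonneg σ)]
    rfl
  have h2 := Measure.pi_map_pi (ι := Fin n) (μ := fun _ => gaussianReal 0 1)
    (f := fun _ x => σ * x) (hμ := fun _ => by rw [h]; infer_instance) (fun _ => by fun_prop)
  simp_rw [h] at h2
  exact h2.symm

instance (n : ℕ) (σ : ℝ) : IsProbabilityMeasure (noiseLaw n σ) := by
  unfold noiseLaw; infer_instance

lemma measurable_response (θ : Fin p → ℝ) :
    Measurable fun z : (Fin n → Fin p → ℝ) × (Fin n → ℝ) =>
      ((Matrix.of z.1).mulVec θ + z.2, z.1) := by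
  refine Measurable.prodMk (measurable_pi_lambda _ fun a => ?_) measurable_fst
  simp only [Pi.add_apply, Matrix.mulVec, dotProduct, Matrix.of_apply]
  fun_prop

instance (n p : ℕ) (σ : ℝ) (θ : Fin p → ℝ) : IsProbabilityMeasure (dataLaw n p σ θ) :=
  Measure.isProbabilityMeasure_map (measurable_response θ).aemeasurable

namespace RandomizedTest

variable (T : RandomizedTest n p)

/-- The conditional probability, given the data, that a randomized test rejects. -/
noncomputable def rejectProb (z : (Fin n → ℝ) × (Fin n → Fin p → ℝ)) : ℝ :=
  (volume : Measure unitInterval).real {u | T.decision z u = true}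

lemma measurableSet_decision (b : Bool) :
    MeasurableSet {z : ((Fin n → ℝ) × (Fin n → Fin p → ℝ)) × unitInterval |
      T.decision z.1 z.2 = b} :=
  T.measurable_decision (measurableSet_singleton b)

lemma measurable_rejectProb : Measurable T.rejectProb :=
  (measurable_measure_prodMk_left (T.measurableSet_decision true)).ennreal_toReal

lemma rejectProb_nonneg (z : (Fin n → ℝ) × (Fin n → Fin p → ℝ)) : 0 ≤ T.rejectProb z :=
  measureReal_nonneg

lemma rejectProb_le_one (z : (Fin n → ℝ) × (Fin n → Fin p → ℝ)) : T.rejectProb z ≤ 1 :=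
  measureReal_le_one

end RandomizedTest

lemma decisionProb_true_eq (σ : ℝ) (T : RandomizedTest n p) (θ : Fin p → ℝ) :
    decisionProb σ T θ true =
      ∫ X, ∫ w, T.rejectProb (Matrix.of X *ᵥ θ + σ • w, X) ∂(stdPi (Fin n)) ∂(designLaw n p) := by
  have hm := T.measurable_rejectProb
  have h1 : decisionProb σ T θ true = ∫ z, T.rejectProb z ∂(dataLaw n p σ θ) := by
    rw [decisionProb, measureReal_def, Measure.prod_apply (T.measurableSet_decision true)]
    exact (integral_toReal
      (measurable_measure_prodMk_left (T.measurableSet_decision true)).aemeasurable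
      (.of_forall fun z => measure_lt_top _ _)).symm
  have hmr : Measurable fun z : (Fin n → Fin p → ℝ) × (Fin n → ℝ) =>
      T.rejectProb (Matrix.of z.1 *ᵥ θ + z.2, z.1) := hm.comp (measurable_response θ)
  rw [h1, dataLaw, integral_map (measurable_response θ).aemeasurable hm.aestronglyMeasurable,
    integral_prod _ (integrable_of_mem_unit hmr (fun _ => T.rejectProb_nonneg _)
      (fun _ => T.rejectProb_le_one _))]
  congr 1
  ext X
  rw [noiseLaw_eq_map, integral_map (by fun_prop)]
  exact (hmr.comp (measurable_prodMk_left (x := X))).aestronglyMeasurable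

lemma decisionProb_nonneg (σ : ℝ) (T : RandomizedTest n p) (θ : Fin p → ℝ) (b : Bool) :
    0 ≤ decisionProb σ T θ b := measureReal_nonneg

lemma decisionProb_le_one (σ : ℝ) (T : RandomizedTest n p) (θ : Fin p → ℝ) (b : Bool) :
    decisionProb σ T θ b ≤ 1 := measureReal_le_one

lemma decisionProb_false_eq (σ : ℝ) (T : RandomizedTest n p) (θ : Fin p → ℝ) :
    decisionProb σ T θ false = 1 - decisionProb σ T θ true := by
  rw [decisionProb, decisionProb, ← probReal_compl_eq_one_sub (T.measurableSet_decision true)]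
  congr 1
  ext z
  simp

lemma bddAbove_decisionProb (σ : ℝ) (T : RandomizedTest n p) (b : Bool) (S : Set (Fin p → ℝ)) :
    BddAbove ((fun θ => decisionProb σ T θ b) '' S) := by
  refine ⟨1, ?_⟩
  rintro _ ⟨θ, _, rfl⟩
  exact decisionProb_le_one σ T θ b

lemma decisionProb_le_typeIError (σ : ℝ) {s₀ : ℕ} {i : Fin p} (T : RandomizedTest n p)
    {θ : Fin p → ℝ} (hθ : θ ∈ Omega0 s₀ i) : decisionProb σ T θ true ≤ typeIError σ s₀ i T :=
  le_csSup (bddAbove_decisionProb σ T true _) ⟨θ, hθ, rfl⟩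

lemma one_sub_typeIIError_le (σ : ℝ) {s₀ : ℕ} {i : Fin p} {μ : ℝ} (T : RandomizedTest n p)
    {θ : Fin p → ℝ} (hθ : θ ∈ Omega1 s₀ i μ) :
    1 - typeIIError σ s₀ i μ T ≤ decisionProb σ T θ true := by
  have : decisionProb σ T θ false ≤ typeIIError σ s₀ i μ T :=
    le_csSup (bddAbove_decisionProb σ T false _) ⟨θ, hθ, rfl⟩
  rw [decisionProb_false_eq] at this
  linarith

lemma typeIIError_nonneg (σ : ℝ) (s₀ : ℕ) (i : Fin p) (μ : ℝ) (T : RandomizedTest n p) :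
    0 ≤ typeIIError σ s₀ i μ T := by
  refine Real.sSup_nonneg ?_
  rintro _ ⟨θ, _, rfl⟩
  exact decisionProb_nonneg σ T θ false

/-- The condition `0 ≤ B` covers an empty set of admissible tests, whose `sSup` is 0 by default. -/
lemma minimaxPower_le {σ : ℝ} {s₀ : ℕ} {i : Fin p} {α μ B : ℝ} (hB : 0 ≤ B)
    (h : ∀ T : RandomizedTest n p, typeIError σ s₀ i T ≤ α → 1 - typeIIError σ s₀ i μ T ≤ B) :
    minimaxPower n σ s₀ i α μ ≤ B := by
  refine Real.sSup_le ?_ hB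
  rintro _ ⟨T, hT, rfl⟩
  exact h T hT

lemma minimaxPower_le_one (n : ℕ) (σ : ℝ) (s₀ : ℕ) (i : Fin p) (α μ : ℝ) :
    minimaxPower n σ s₀ i α μ ≤ 1 :=
  minimaxPower_le zero_le_one fun T _ => sub_le_self _ (typeIIError_nonneg σ s₀ i μ T)

/-- The parameter with the value `b` at `i`, the values `t` at the positions `e`, and the value `0`
elsewhere. -/
noncomputable def sparseParam (e : Fin k → Fin p) (i : Fin p) (b : ℝ) (t : Fin k → ℝ) : Fin p → ℝ :=
  ∑ l, Pi.single (e l) (t l) + Pi.single i b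

lemma mulVec_sparseParam (X : Fin n → Fin p → ℝ) (e : Fin k → Fin p) (i : Fin p) (b : ℝ)
    (t : Fin k → ℝ) : Matrix.of X *ᵥ sparseParam e i b t =
      Matrix.of (fun a l => X a (e l)) *ᵥ t + b • fun a => X a i := by
  ext a
  rw [sparseParam, Matrix.mulVec_add, Matrix.mulVec_sum]
  simp [Matrix.mulVec_single, Matrix.mulVec, dotProduct, mul_comm, Finset.sum_apply]

lemma sparseParam_apply_self {e : Fin k → Fin p} {i : Fin p} (hi : ∀ l, e l ≠ i) (b : ℝ)
    (t : Fin k → ℝ) : sparseParam e i b t i = b := by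
  simp [sparseParam, Finset.sum_apply, fun l => (hi l).symm]

lemma hammingNorm_sparseParam_le (e : Fin k → Fin p) (i : Fin p) (b : ℝ) (t : Fin k → ℝ) :
    hammingNorm (sparseParam e i b t) ≤ k + 1 := by
  have hsub : (Finset.univ.filter fun j => sparseParam e i b t j ≠ 0) ⊆
      insert i (Finset.univ.image e) := by
    intro j hj
    rw [Finset.mem_filter] at hj
    by_contra hj2
    simp only [Finset.mem_insert, Finset.mem_image, Finset.mem_univ, true_and, not_or,
      not_exists] at hj2
    refine hj.2 ?_
    simp [sparseParam, Finset.sum_apply, hj2.1, fun l => Ne.symm (hj2.2 l)]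
  refine (Finset.card_le_card hsub).trans ((Finset.card_insert_le _ _).trans ?_)
  exact Nat.succ_le_succ (Finset.card_image_le.trans (by simp))

lemma decisionProb_sparseParam (σ : ℝ) (T : RandomizedTest n p) (e : Fin k → Fin p) (i : Fin p)
    (b : ℝ) (t : Fin k → ℝ) : decisionProb σ T (sparseParam e i b t) true =
      ∫ X, condMean T.rejectProb σ e i b X t ∂(designLaw n p) := by
  rw [decisionProb_true_eq]
  simp only [mulVec_sparseParam]
  rfl

/-- The power of a test with small type I error is bounded by that of the two-sided test of the
shift of a normal variable, up to the probability of an exceptional design. -/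
lemma one_sub_typeIIError_le_twoSidedPower {σ c ξ μ : ℝ} {s₀ : ℕ} {i : Fin p} (hσ : 0 < σ)
    (hk : k < n) (hks : k + 1 ≤ s₀) (hkp : k + 1 ≤ p) (hc : 0 ≤ c) (hξ : 0 ≤ ξ) (hμ : 0 ≤ μ)
    (T : RandomizedTest n p) (hT : typeIError σ s₀ i T ≤ twoSidedPower c 0) :
    1 - typeIIError σ s₀ i μ T ≤ twoSidedPower c (μ * (√((n : ℝ) - k) + ξ) / σ) +
      Real.exp (-ξ ^ 2 / 2) := by
  obtain ⟨q, rfl⟩ : ∃ q, p = q + 1 := ⟨p - 1, by omega⟩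
  let e : Fin k → Fin (q + 1) := fun l => i.succAbove (Fin.castLE (by omega) l)
  have he : Function.Injective e :=
    (Fin.succAbove_right_injective).comp (Fin.castLE_injective _)
  have hi : ∀ l, e l ≠ i := fun l => Fin.succAbove_ne i _
  have hnorm : ∀ b t, hammingNorm (sparseParam e i b t) ≤ s₀ := fun b t =>
    (hammingNorm_sparseParam_le e i b t).trans hks
  have key := power_le T.measurable_rejectProb T.rejectProb_nonneg T.rejectProb_le_one hσ hk he hi
    (α := twoSidedPower c 0) (π := 1 - typeIIError σ s₀ i μ T) hc hξ hμ
    (fun t => by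
      rw [← decisionProb_sparseParam]
      exact (decisionProb_le_typeIError σ T
        ⟨hnorm 0 t, sparseParam_apply_self hi 0 t⟩).trans hT)
    (fun t => by
      rw [← decisionProb_sparseParam]
      refine one_sub_typeIIError_le σ T ⟨hnorm μ t, ?_⟩
      rw [sparseParam_apply_self hi]
      exact le_abs_self μ)
    (fun t => by
      rw [← decisionProb_sparseParam]
      refine one_sub_typeIIError_le σ T ⟨hnorm (-μ) t, ?_⟩
      rw [sparseParam_apply_self hi, abs_neg]
      exact le_abs_self μ)
  -- The level bound equals `twoSidedPower c 0`, so the two terms with the multiplier cancel.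
  linarith

lemma minimaxPower_le_twoSidedPower {σ c ξ μ α : ℝ} {s₀ : ℕ} {i : Fin p} (hσ : 0 < σ)
    (hk : k < n) (hks : k + 1 ≤ s₀) (hkp : k + 1 ≤ p) (hc : 0 ≤ c) (hξ : 0 ≤ ξ) (hμ : 0 ≤ μ)
    (hα : α ≤ twoSidedPower c 0) :
    minimaxPower n σ s₀ i α μ ≤ twoSidedPower c (μ * (√((n : ℝ) - k) + ξ) / σ) +
      Real.exp (-ξ ^ 2 / 2) :=
  minimaxPower_le (add_nonneg (twoSidedPower_nonneg _ _) (Real.exp_pos _).le) fun T hT =>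
    one_sub_typeIIError_le_twoSidedPower hσ hk hks hkp hc hξ hμ T (hT.trans hα)

lemma minimaxPower_le_G {σ ξ μ α : ℝ} {s₀ : ℕ} {i : Fin p} (hσ : 0 < σ)
    (hk : k < n) (hks : k + 1 ≤ s₀) (hkp : k + 1 ≤ p) (hξ : 0 ≤ ξ) (hμ : 0 ≤ μ)
    (h0 : 0 ≤ α) (h1 : α ≤ 1) :
    minimaxPower n σ s₀ i α μ ≤ G α (μ * (√((n : ℝ) - k) + ξ) / σ) + Real.exp (-ξ ^ 2 / 2) := by
  rcases h0.eq_or_lt with rfl | h0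
  · rw [G_zero]
    -- Level 0 corresponds to an infinite threshold, reached as the limit of the bounds for finite
    -- `c`.
    refine ge_of_tendsto ((tendsto_twoSidedPower_atTop (μ * (√((n : ℝ) - k) + ξ) / σ)).add_const
      (Real.exp (-ξ ^ 2 / 2))) ?_
    filter_upwards [Filter.eventually_ge_atTop 0] with c hc
    exact minimaxPower_le_twoSidedPower hσ hk hks hkp hc hξ hμ (twoSidedPower_nonneg c 0)
  · obtain ⟨c, hc, hce⟩ := exists_twoSidedPower_eq h0 h1
    rw [G_eq_twoSidedPower hc hce]
    refine minimaxPower_le_twoSidedPower hσ hk hks hkp hc hξ hμ ?_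
    rw [twoSidedPower_zero hc, hce]
    linarith

end Tests

end GaussianDesign

/-! ### The two claims -/

open GaussianDesign

theorem corollary2p6 :
    (∀ (n p s₀ : ℕ) (i : Fin p) (σ μ α ξ : ℝ),
      1 ≤ s₀ → s₀ ≤ p → s₀ ≤ n + 1 → 0 < σ → 0 < μ → α ∈ Set.Icc (0 : ℝ) 1 →
      ξ ∈ Set.Icc 0 (3 / 2 * Real.sqrt ((n : ℝ) - s₀ + 1)) →
      GaussianDesign.minimaxPower n σ s₀ i α μ ≤
        GaussianDesign.G α (μ * (Real.sqrt ((n : ℝ) - s₀ + 1) + ξ) / σ)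
          + Real.exp (-ξ ^ 2 / 8)) ∧
    (∀ α β : ℝ, 0 < α → α < 1 - β → 1 - β < 1 →
      ∃ c : ℝ, 0 < c ∧
        ∀ (n p s₀ : ℕ) (i : Fin p) (σ μ : ℝ),
          1 ≤ n → 1 ≤ s₀ → s₀ ≤ p → 0 < σ → 0 < μ →
          1 - β ≤ GaussianDesign.minimaxPower n σ s₀ i α μ →
          c * σ / Real.sqrt n ≤ μ) := by
  constructor
  · intro n p s₀ i σ μ α ξ hs hsp hsn hσ hμ hα hξ
    obtain ⟨k, rfl⟩ : ∃ k, s₀ = k + 1 := ⟨s₀ - 1, by omega⟩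
    have hcast : (n : ℝ) - ((k + 1 : ℕ) : ℝ) + 1 = n - k := by push_cast; ring
    rw [hcast] at hξ ⊢
    -- For `s₀ = n + 1` no residual dimension is left, but the range of `ξ` shrinks to 0 and the
    -- exponential term is already 1.
    rcases (show k ≤ n by omega).eq_or_lt with rfl | hk
    · have hξ0 : ξ = 0 := by
        have h2 := hξ.2
        rw [sub_self, Real.sqrt_zero, mul_zero] at h2
        exact le_antisymm h2 hξ.1
      refine (minimaxPower_le_one k σ (k + 1) i α μ).trans ?_
      have := G_nonneg hα.1 hα.2 (μ * (√((k : ℝ) - k) + ξ) / σ)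
      have h1 : Real.exp (-ξ ^ 2 / 8) = 1 := by rw [hξ0]; simp
      linarith
    · refine (minimaxPower_le_G hσ hk le_rfl hsp hξ.1 hμ.le hα.1 hα.2).trans ?_
      refine add_le_add le_rfl (Real.exp_le_exp.2 ?_)
      nlinarith [sq_nonneg ξ]
  · intro α β hα hαβ hβ
    obtain ⟨c₀, hc₀, hce⟩ := exists_twoSidedPower_eq hα (hαβ.trans hβ).le
    have hlevel : twoSidedPower c₀ 0 = α := by rw [twoSidedPower_zero hc₀, hce]; ring
    set d := 1 - β - α
    have hd : 0 < d := by simp only [d]; linarith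
    -- This makes the exceptional probability `exp (-2 / d)`, below `d / 2` because `exp x > x`.
    set ξ := √(4 / d)
    have hξ0 : 0 ≤ ξ := Real.sqrt_nonneg _
    have hξ2 : ξ ^ 2 = 4 / d := Real.sq_sqrt (by positivity)
    have hexp : Real.exp (-ξ ^ 2 / 2) < d / 2 := by
      have e1 : -ξ ^ 2 / 2 = -(2 / d) := by rw [hξ2]; ring
      rw [e1, Real.exp_neg, show d / 2 = (2 / d)⁻¹ by rw [inv_div]]
      refine inv_strictAnti₀ (by positivity) ?_
      linarith [Real.add_one_le_exp (2 / d)]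
    -- As `√n + ξ ≤ √n * (1 + ξ)` for `n ≥ 1`, a smaller `μ` gives a shift of at most `d / 2`. The
    -- power is then below `α + d / 2 + d / 2 = 1 - β`.
    refine ⟨d / (2 * (1 + ξ)), by positivity, ?_⟩
    intro n p s₀ i σ μ hn hs hsp hσ hμ hpow
    by_contra hlt
    rw [not_le] at hlt
    have hn1 : (1 : ℝ) ≤ √n := Real.one_le_sqrt.2 (by exact_mod_cast hn)
    have hn0 : 0 < √(n : ℝ) := by linarith
    -- Taking no nuisance coordinates makes the bound independent of `s₀` and `p`, with all `n`
    -- dimensions left.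
    have key := minimaxPower_le_twoSidedPower (k := 0) (α := α) (i := i) hσ (show 0 < n by omega)
      (show 0 + 1 ≤ s₀ by omega) (show 0 + 1 ≤ p by omega) hc₀ hξ0 hμ.le hlevel.ge
    rw [Nat.cast_zero, sub_zero] at key
    have hu : μ * (√n + ξ) / σ ≤ d / 2 := by
      rw [div_le_iff₀ hσ]
      rw [lt_div_iff₀ hn0] at hlt
      have h1 : √n + ξ ≤ √n * (1 + ξ) := by nlinarith
      calc μ * (√n + ξ) ≤ μ * (√n * (1 + ξ)) := by gcongr
        _ = (μ * √n) * (1 + ξ) := by ring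
        _ ≤ (d / (2 * (1 + ξ)) * σ) * (1 + ξ) := by gcongr
        _ = d / 2 * σ := by field_simp
    have h2 := twoSidedPower_le_add hc₀ (u := μ * (√n + ξ) / σ) (by positivity)
    simp only [d] at hu hexp
    linarith
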